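/- Let $\mathbb K$ be a field, let $a_1,\dots,a_n\ge 1$ be integers, and let $A=(x_{i_1,\dots,i_n})$, $1\le i_j\le a_j$, be the generic $a_1\times\cdots\times a_n$ table over $R=\mathbb K[x_{i_1,\dots,i_n}]$. For $\mathscr J\subseteq\{1,\dots,n\}$ let the margin $A_{\mathscr J}$ be the table indexed by the coordinates in $\mathscr J$ whose entries are obtained from $A$ by summing over all the coordinates not in $\mathscr J$, and let $L_{\mathscr J}\subseteq R$ be the ideal generated by the entries of $A_{\mathscr J}$. For a table $B=(b_i)$ with entries in $R$ let $I(B)\subseteq R$ be the ideal generated by the generalized $2\times 2$ minors $b_ib_j-b_{i'}b_{j'}$, where $i',j'$ arise from the multi-indices $i,j$ by interchanging their $l$-th coordinates, for some coordinate $l$. Let $\Delta$ be a simplicial complex on $\{1,\dots,n\}$ (a family of subsets closed under taking subsets; a facet is a maximal member, and not every $\{j\}$ need belong to $\Delta$). Put $I_\Delta=\sum_{\mathscr J\in\Delta}I(A_{\mathscr J})\subseteq R$. Let $S_\Delta$ be the polynomial ring over $\mathbb K$ with one variable for every entry of every margin $A_{\mathscr J}$, $\mathscr J\in\Delta$; let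 $\tau_\Delta\colon S_\Delta\to R$ send each variable to the corresponding entry; let $\sigma_\Delta\colon S_\Delta\to\mathbb K[y_{j,i}\mid 1\le j\le n,\ 1\le i\le a_j]$ be $\tau_\Delta$ followed by $x_{i_1,\dots,i_n}\mapsto\prod_j y_{j,i_j}$; and let $P_\Delta\subseteq R$ be the ideal generated by $\tau_\Delta(\ker\sigma_\Delta)$. Suppose that $\Delta$ has exactly two facets $\mathscr J_1\ne\mathscr J_2$. For $i_1\in\mathscr J_1\smallsetminus\mathscr J_2$ and $i_2\in\mathscr J_2\smallsetminus\mathscr J_1$ put $$Q_{i_1,i_2}=I_\Delta+L_{\mathscr J_1\smallsetminus\{i_1\}}+L_{\mathscr J_2\smallsetminus\{i_2\}}.$$ Then: 1. Every $Q_{i_1,i_2}$ is a prime ideal. 2. If $a_j\ge 2$ for all $j$ and $\mathscr J_1\cap\mathscr J_2\neq\emptyset$, then the minimal primes over $I_\Delta$ are exactly $P_\Delta$ and the ideals $Q_{i_1,i_2}$ with $i_1\in\mathscr J_1\smallsetminus\mathscr J_2$, $i_2\in\mathscr J_2\smallsetminus\mathscr J_1$. 3. In general (all $a_j\ge1$,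 $\mathscr J_1\cap\mathscr J_2$ possibly empty), the minimal primes over $I_\Delta$ are exactly $P_\Delta$ and those $Q_{i_1,i_2}$ for which $a_{i_1}\ge 2$, $a_{i_2}\ge 2$ and $a_c\ge 2$ for some $c\in\mathscr J_1\cap\mathscr J_2$. In particular $P_\Delta$ is the only minimal prime if $\mathscr J_1\cap\mathscr J_2=\emptyset$. -/

import Mathlib

noncomputable section

namespace MarginalIndependence

/-- Index set of an array whose coordinates are labelled by `J ⊆ {1, …, n}`; coordinate `j` takes
`a j` values. For `J = univ` this indexes (up to relabelling) the full table. -/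
abbrev Cell {n : ℕ} (a : Fin n → ℕ) (J : Finset (Fin n)) : Type :=
  (j : J) → Fin (a j)

/-- The polynomial ring `𝕂[x_{i₁,…,iₙ}]` in the entries of the generic `a₁ × ⋯ × aₙ` table. -/
abbrev TableRing (K : Type*) [Field K] {n : ℕ} (a : Fin n → ℕ) : Type _ :=
  MvPolynomial ((j : Fin n) → Fin (a j)) K

/-- The margin `A_J` of the generic table `A`: the entry at `s` is the sum of all the variables
`x_i` whose index `i` agrees with `s` on `J`. -/
def margin (K : Type*) [Field K] {n : ℕ} (a : Fin n → ℕ) (J : Finset (Fin n))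
    (s : Cell a J) : TableRing K a :=
  ∑ i : (j : Fin n) → Fin (a j) with ∀ j : J, i j = s j, MvPolynomial.X i

/-- The ideal generated by the generalized `2 × 2` minors of an array `B` with entries in a
commutative ring: for indices `i, j` and a coordinate `l`, the minor is
`B_i B_j - B_{j with l-th coordinate i_l} B_{i with l-th coordinate j_l}`. -/
def segreIdeal {R : Type*} [CommRing R] {ι : Type*} [DecidableEq ι] {β : ι → Type*}
    (B : ((j : ι) → β j) → R) : Ideal R :=
  Ideal.span {f | ∃ (l : ι) (i j : (j : ι) → β j),
    f = B i * B j - B (Function.update j l (i l)) * B (Function.update i l (j l))}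

/-- `I_Δ`: the sum of the ideals of `2 × 2` minors of the margins `A_J`, `J ∈ Δ`. -/
def independenceIdeal (K : Type*) [Field K] {n : ℕ} (a : Fin n → ℕ)
    (Δ : Set (Finset (Fin n))) : Ideal (TableRing K a) :=
  ⨆ J ∈ Δ, segreIdeal (margin K a J)

/-- `L_J`: the ideal generated by the entries of the margin `A_J`. -/
def marginIdeal (K : Type*) [Field K] {n : ℕ} (a : Fin n → ℕ) (J : Finset (Fin n)) :
    Ideal (TableRing K a) :=
  Ideal.span (Set.range (margin K a J))

/-- `S_Δ`: the polynomial ring with one variable for every entry of every margin `A_J`, `J ∈ Δ`. -/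
abbrev MarginRing (K : Type*) [Field K] {n : ℕ} (a : Fin n → ℕ)
    (Δ : Set (Finset (Fin n))) : Type _ :=
  MvPolynomial ((J : Δ) × Cell a J.1) K

/-- `τ_Δ : S_Δ → R`, sending each formal symbol to the corresponding entry of `A_J`. -/
def tau (K : Type*) [Field K] {n : ℕ} (a : Fin n → ℕ) (Δ : Set (Finset (Fin n))) :
    MarginRing K a Δ →ₐ[K] TableRing K a :=
  MvPolynomial.aeval fun p => margin K a p.1.1 p.2

/-- The Segre parametrization `x_{i₁,…,iₙ} ↦ ∏ j, y_{j,i_j}`. -/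
def segreMap (K : Type*) [Field K] {n : ℕ} (a : Fin n → ℕ) :
    TableRing K a →ₐ[K] MvPolynomial ((j : Fin n) × Fin (a j)) K :=
  MvPolynomial.aeval fun i => ∏ j, MvPolynomial.X ⟨j, i j⟩

/-- `σ_Δ : S_Δ → 𝕂[y_{j,i}]`, the composite of `τ_Δ` and the Segre parametrization. -/
def sigma (K : Type*) [Field K] {n : ℕ} (a : Fin n → ℕ) (Δ : Set (Finset (Fin n))) :
    MarginRing K a Δ →ₐ[K] MvPolynomial ((j : Fin n) × Fin (a j)) K :=
  (segreMap K a).comp (tau K a Δ)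

/-- `P_Δ` as an ideal of `R`: the ideal generated by the image under `τ_Δ` of `ker σ_Δ`. -/
def mainIdeal (K : Type*) [Field K] {n : ℕ} (a : Fin n → ℕ) (Δ : Set (Finset (Fin n))) :
    Ideal (TableRing K a) :=
  (RingHom.ker (sigma K a Δ)).map (tau K a Δ)

/-- The facets of `Δ`: its inclusion-maximal members. -/
def facets {n : ℕ} (Δ : Set (Finset (Fin n))) : Set (Finset (Fin n)) :=
  {J | Maximal (· ∈ Δ) J}

/-- The ideal `I_Δ + L_{J₁ ∖ i₁} + L_{J₂ ∖ i₂}`. -/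
def twoFacetIdeal (K : Type*) [Field K] {n : ℕ} (a : Fin n → ℕ) (Δ : Set (Finset (Fin n)))
    (J₁ J₂ : Finset (Fin n)) (i₁ i₂ : Fin n) : Ideal (TableRing K a) :=
  independenceIdeal K a Δ + marginIdeal K a (J₁.erase i₁) + marginIdeal K a (J₂.erase i₂)

end MarginalIndependence

end

/-!
A prime ideal containing `I_Δ` is the kernel of a homomorphism `φ` to a field, and `φ` maps `A_{J₁}`
and `A_{J₂}` to tables of rank one. If `φ` does not kill the common margin `A_{J₁ ∩ J₂}`, the two
rank-one tables have proportional factors along `J₁ ∩ J₂`, so `φ` is, on these margins, the image of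
a product table and `P_Δ ⊆ ker φ`; the degenerate case in which a product of factor sums vanishes is
reached by deforming the factors over a polynomial ring. If `φ` kills `A_{J₁ ∩ J₂}`, one factor sum
along `J₁ \ J₂` and one along `J₂ \ J₁` vanish, that is, `φ` kills some `A_{J₁ \ i₁}` and
`A_{J₂ \ i₂}`, so `Q_{i₁,i₂} ⊆ ker φ`.

Both kinds of ideals are prime because of a linear change of coordinates of `R` after which every
margin is a coordinate subtable: `P_Δ` becomes the extension of a kernel in fewer variables, and
`Q_{i₁,i₂}` the kernel of a monomial map that also sends some variables to `0`.
-/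

noncomputable section

namespace MarginalIndependence

open Function MvPolynomial

variable {K : Type*} [Field K] {n : ℕ} {a : Fin n → ℕ}

section Tables

variable {ι : Type*} [DecidableEq ι] {β : ι → Type*}

/-- A table with entries in a multiplicative structure satisfies the exchange relations if
interchanging one coordinate of two indices does not change the product of the two entries.
For entries in a ring this is the vanishing of all generalized `2 × 2` minors. -/
def IsSwap {M : Type*} [Mul M] (b : ((j : ι) → β j) → M) : Prop :=
  ∀ (l : ι) (i k : (j : ι) → β j),
    b i * b k = b (update k l (i l)) * b (update i l (k l))

theorem isSwap_prod {M : Type*} [CommMonoid M] (J : Finset ι) (w : (j : ι) → β j → M) :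
    IsSwap fun i : (j : ι) → β j => ∏ j ∈ J, w j (i j) := by
  intro l i k
  simp only [← Finset.prod_mul_distrib]
  refine Finset.prod_congr rfl fun j _ => ?_
  obtain rfl | h := eq_or_ne j l
  · simp
  · simp [update_of_ne h, mul_comm]

theorem segreIdeal_le_ker_iff {R B F : Type*} [CommRing R] [CommRing B] [FunLike F R B]
    [RingHomClass F R B] (φ : F) (b : ((j : ι) → β j) → R) :
    segreIdeal b ≤ RingHom.ker φ ↔ IsSwap fun i => φ (b i) := by
  rw [segreIdeal, Ideal.span_le]
  constructor
  · intro h l i k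
    simpa [sub_eq_zero] using h ⟨l, i, k, rfl⟩
  · rintro h _ ⟨l, i, k, rfl⟩
    simpa [sub_eq_zero] using h l i k

theorem IsSwap.of_eq_sum_update {R : Type*} [CommRing R] {b b' : ((j : ι) → β j) → R}
    (hb : IsSwap b) (j : ι) [Fintype (β j)] (g : β j → β j → R)
    (h : ∀ i, b' i = ∑ x, g (i j) x * b (update i j x)) : IsSwap b' := by
  intro l i k
  simp only [h, Finset.sum_mul_sum]
  obtain rfl | hl := eq_or_ne l j
  · simp only [update_self, update_idem]
    refine Finset.sum_congr rfl fun x _ => Finset.sum_congr rfl fun y _ => ?_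
    have hxy := hb l (update i l x) (update k l y)
    simp only [update_self, update_idem] at hxy
    linear_combination g (i l) x * g (k l) y * hxy
  · rw [Finset.sum_comm]
    refine Finset.sum_congr rfl fun x _ => Finset.sum_congr rfl fun y _ => ?_
    have hyx := hb l (update i j y) (update k j x)
    rw [update_of_ne hl, update_of_ne hl, update_comm hl.symm, update_comm hl.symm] at hyx
    rw [update_of_ne hl.symm, update_of_ne hl.symm]
    linear_combination g (i j) y * g (k j) x * hyx

theorem IsSwap.exists_eq_mul_prod {F : Type*} [Field F] {b : ((j : ι) → β j) → F} (hb : IsSwap b)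
    {J : Finset ι} (hbJ : DependsOn b J) {s : (j : ι) → β j} (hs : b s ≠ 0) :
    ∃ w : (j : ι) → β j → F, (∀ j, w j (s j) = 1) ∧ ∀ i, b i = b s * ∏ j ∈ J, w j (i j) := by
  refine ⟨fun j v => b (update s j v) / b s, fun j => by simp [hs], fun i => ?_⟩
  have reset : ∀ E : Finset ι,
      b i = b (E.piecewise s i) * ∏ j ∈ E, b (update s j (i j)) / b s := by
    intro E
    induction E using Finset.induction_on with
    | empty => simp
    | insert l E hl ih =>
      have hswap := hb l (E.piecewise s i) s
      rw [Finset.piecewise_eq_of_notMem _ _ _ hl, ← Finset.piecewise_insert] at hswap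
      rw [ih, Finset.prod_insert hl, ← mul_assoc]
      congr 1
      field_simp
      rw [hswap, mul_comm]
  rw [reset J, hbJ (y := s) fun j hj => Finset.piecewise_eq_of_mem _ _ _ hj]

theorem IsSwap.exists_cons {M : Type*} [CommMonoid M] {b : ((j : ι) → β j) → M} (hb : IsSwap b)
    {m : Multiset ((j : ι) → β j)} (hm : m ≠ 0) {i : (j : ι) → β j}
    (hi : ∀ j, i j ∈ m.map fun k => k j) (E : Finset ι) :
    ∃ k m', (∀ j ∈ E, k j = i j) ∧ (∀ j, (k ::ₘ m').map (fun k => k j) = m.map fun k => k j) ∧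
      ((k ::ₘ m').map b).prod = (m.map b).prod := by
  induction E using Finset.induction_on with
  | empty =>
    obtain ⟨k, hk⟩ := Multiset.exists_mem_of_ne_zero hm
    obtain ⟨m', rfl⟩ := Multiset.exists_cons_of_mem hk
    exact ⟨k, m', by simp, fun _ => rfl, rfl⟩
  | insert l E hl ih =>
    obtain ⟨k, m', hkE, hmap, hprod⟩ := ih
    by_cases hkl : k l = i l
    · exact ⟨k, m', by simpa [hkl] using hkE, hmap, hprod⟩
    have hil := hi l
    rw [← hmap l, Multiset.map_cons, Multiset.mem_cons] at hil
    obtain ⟨k', hk', hk'l⟩ := Multiset.mem_map.1 (hil.resolve_left (Ne.symm hkl))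
    obtain ⟨m'', rfl⟩ := Multiset.exists_cons_of_mem hk'
    refine ⟨update k l (k' l), update k' l (k l) ::ₘ m'', ?_, fun j => ?_, ?_⟩
    · refine (Finset.forall_mem_insert _ _ _).2 ⟨by simpa using hk'l, fun j hj => ?_⟩
      rw [update_of_ne (ne_of_mem_of_not_mem hj hl), hkE j hj]
    · rw [← hmap j, Multiset.map_cons, Multiset.map_cons, Multiset.map_cons, Multiset.map_cons]
      obtain rfl | hj := eq_or_ne j l
      · simpa only [update_self] using Multiset.cons_swap _ _ _
      · simp only [update_of_ne hj]
    · rw [← hprod]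
      simp only [Multiset.map_cons, Multiset.prod_cons, ← mul_assoc]
      rw [hb l k k', mul_comm (b (update k l (k' l)))]

theorem IsSwap.prod_eq_prod [Finite ι] [Nonempty ι] {M : Type*} [CommMonoid M]
    {b : ((j : ι) → β j) → M} (hb : IsSwap b) {m m' : Multiset ((j : ι) → β j)}
    (h : ∀ j, m.map (fun k => k j) = m'.map fun k => k j) :
    (m.map b).prod = (m'.map b).prod := by
  cases nonempty_fintype ι
  induction m' using Multiset.induction_on generalizing m with
  | empty =>
    obtain rfl : m = 0 := by simpa using h (Classical.arbitrary ι)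
    rfl
  | cons i m' ih =>
    have hm : m ≠ 0 := by
      rintro rfl
      simpa using h (Classical.arbitrary ι)
    have hi : ∀ j, i j ∈ m.map fun k => k j := fun j => by simp [h j]
    obtain ⟨k, m'', hk, hmap, hprod⟩ := hb.exists_cons hm hi Finset.univ
    obtain rfl : k = i := funext fun j => hk j (Finset.mem_univ j)
    rw [← hprod, Multiset.map_cons, Multiset.map_cons, Multiset.prod_cons, Multiset.prod_cons,
      ih fun j => ?_]
    simpa only [Multiset.map_cons, Multiset.cons_inj_right] using (hmap j).trans (h j)

end Tables

@[elab_as_elim]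
theorem induction_downward_insert {ι : Type*} [DecidableEq ι] {J' : Finset ι}
    {P : ∀ J, J ⊆ J' → Prop} (top : P J' subset_rfl)
    (step : ∀ J, ∀ l ∉ J, ∀ h : insert l J ⊆ J',
      P (insert l J) h → P J ((Finset.subset_insert l J).trans h))
    {J : Finset ι} (hJ : J ⊆ J') : P J hJ := by
  induction hE : J' \ J using Finset.induction_on generalizing J with
  | empty =>
    obtain rfl := hJ.antisymm (Finset.sdiff_eq_empty_iff_subset.1 hE)
    exact top
  | insert l E hl ih =>
    have hlJ : l ∈ J' ∧ l ∉ J := Finset.mem_sdiff.1 (hE ▸ Finset.mem_insert_self l E)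
    refine step J l hlJ.2 (Finset.insert_subset hlJ.1 hJ) (ih _ ?_)
    rw [Finset.sdiff_insert, hE, Finset.erase_insert hl]

section FullMargin

variable (K) in
/-- The margin `A_J` as a table indexed by the cells of the full table, so that tables with
different `J` have the same index type. -/
def fullMargin (J : Finset (Fin n)) (i : (j : Fin n) → Fin (a j)) : TableRing K a :=
  margin K a J fun j => i j

theorem fullMargin_eq (J : Finset (Fin n)) (i : (j : Fin n) → Fin (a j)) :
    fullMargin K J i = ∑ k : (j : Fin n) → Fin (a j) with ∀ j ∈ J, k j = i j, X k := by
  simp [fullMargin, margin]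

theorem dependsOn_fullMargin (J : Finset (Fin n)) :
    DependsOn (fullMargin K (a := a) J) J := fun _ _ h =>
  congrArg (margin K a J) (funext fun j => h j j.2)

theorem fullMargin_update_of_notMem {J : Finset (Fin n)} {l : Fin n} (hl : l ∉ J)
    (i : (j : Fin n) → Fin (a j)) (v : Fin (a l)) :
    fullMargin K J (update i l v) = fullMargin K J i :=
  dependsOn_fullMargin J fun _ hj => update_of_ne (ne_of_mem_of_not_mem hj hl) _ _

theorem fullMargin_univ (i : (j : Fin n) → Fin (a j)) :
    fullMargin K Finset.univ i = X i := by
  have hi : (Finset.univ.filter fun k : (j : Fin n) → Fin (a j) => ∀ j ∈ Finset.univ, k j = i j)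
      = {i} := by
    ext k
    simp [funext_iff]
  rw [fullMargin_eq, hi, Finset.sum_singleton]

theorem fullMargin_eq_sum_insert {J : Finset (Fin n)} {l : Fin n} (hl : l ∉ J)
    (i : (j : Fin n) → Fin (a j)) :
    fullMargin K J i = ∑ v, fullMargin K (insert l J) (update i l v) := by
  simp only [fullMargin_eq]
  rw [← Finset.sum_fiberwise_of_maps_to (t := Finset.univ) (g := fun k => k l)
    fun _ _ => Finset.mem_univ _]
  refine Finset.sum_congr rfl fun v _ => Finset.sum_congr ?_ fun _ _ => rfl
  ext k
  simp only [Finset.mem_filter, Finset.mem_univ, true_and, Finset.mem_insert, forall_eq_or_imp,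
    update_self]
  rw [and_comm]
  refine and_congr_right fun _ => forall₂_congr fun j hj => ?_
  rw [update_of_ne (ne_of_mem_of_not_mem hj hl)]

section Maps

variable {B F : Type*} [CommRing B] [FunLike F (TableRing K a) B]
  [AddMonoidHomClass F (TableRing K a) B]

theorem map_fullMargin_eq_prod (φ : F) {J J' : Finset (Fin n)} (c : B)
    {w : (j : Fin n) → Fin (a j) → B}
    (h : ∀ i, φ (fullMargin K J' i) = c * ∏ j ∈ J', w j (i j)) (hJ : J ⊆ J')
    (i : (j : Fin n) → Fin (a j)) :
    φ (fullMargin K J i) = c * (∏ j ∈ J, w j (i j)) * ∏ j ∈ J' \ J, ∑ v, w j v := by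
  induction hJ using induction_downward_insert generalizing i with
  | top => simp [h]
  | step J l hl hsub ih =>
    have hl' : l ∈ J' \ J := Finset.mem_sdiff.2 ⟨hsub (Finset.mem_insert_self l J), hl⟩
    have prod_update : ∀ v, ∏ j ∈ J, w j (update i l v j) = ∏ j ∈ J, w j (i j) := fun v =>
      Finset.prod_congr rfl fun j hj => by rw [update_of_ne (ne_of_mem_of_not_mem hj hl)]
    simp only [fullMargin_eq_sum_insert hl, map_sum, ih, Finset.prod_insert hl, update_self,
      prod_update]
    rw [← Finset.sum_mul, ← Finset.mul_sum, ← Finset.sum_mul, Finset.sdiff_insert,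
      ← Finset.mul_prod_erase _ _ hl']
    ring

theorem map_fullMargin_eq_zero (φ : F) {J J' : Finset (Fin n)} (hJ : J ⊆ J')
    (i : (j : Fin n) → Fin (a j))
    (h : ∀ k : (j : Fin n) → Fin (a j), (∀ j ∈ J, k j = i j) → φ (fullMargin K J' k) = 0) :
    φ (fullMargin K J i) = 0 := by
  induction hJ using induction_downward_insert generalizing i with
  | top => exact h i fun _ _ => rfl
  | step J l hl _ ih =>
    rw [fullMargin_eq_sum_insert hl, map_sum]
    refine Finset.sum_eq_zero fun v _ => ih _ fun k hk => h k fun j hj => ?_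
    rw [hk j (Finset.mem_insert_of_mem hj), update_of_ne (ne_of_mem_of_not_mem hj hl)]

theorem isSwap_fullMargin_mono (φ : F) {J J' : Finset (Fin n)} (hJ : J ⊆ J')
    (h : IsSwap fun i => φ (fullMargin K J' i)) : IsSwap fun i => φ (fullMargin K J i) := by
  induction hJ using induction_downward_insert with
  | top => exact h
  | step J l hl _ ih =>
    refine ih.of_eq_sum_update l (fun _ _ => 1) fun i => ?_
    simp only [fullMargin_eq_sum_insert hl, map_sum, one_mul]

end Maps

section Restrict

theorem restrict_update {J : Finset (Fin n)} (i : (j : Fin n) → Fin (a j)) (l : J)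
    (v : Fin (a l)) :
    (fun j : J => update i l v j) = update (fun j : J => i j) l v := by
  funext j
  obtain rfl | h := eq_or_ne j l
  · simp
  · rw [update_of_ne h, update_of_ne (Subtype.coe_ne_coe.2 h)]

variable [∀ j, NeZero (a j)]

theorem exists_restrict_eq {J : Finset (Fin n)} (s : Cell a J) :
    ∃ i : (j : Fin n) → Fin (a j), (fun j : J => i j) = s :=
  ⟨fun j => if h : j ∈ J then s ⟨j, h⟩ else 0, funext fun j => dif_pos j.2⟩

variable {B F : Type*} [CommRing B] [FunLike F (TableRing K a) B]
  [RingHomClass F (TableRing K a) B]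

theorem marginIdeal_le_ker_iff (φ : F) (J : Finset (Fin n)) :
    marginIdeal K a J ≤ RingHom.ker φ ↔ ∀ i, φ (fullMargin K J i) = 0 := by
  rw [marginIdeal, Ideal.span_le, Set.range_subset_iff]
  refine ⟨fun h i => h _, fun h s => ?_⟩
  obtain ⟨i, rfl⟩ := exists_restrict_eq s
  exact h i

theorem segreIdeal_margin_le_ker_iff (φ : F) (J : Finset (Fin n)) :
    segreIdeal (margin K a J) ≤ RingHom.ker φ ↔ IsSwap fun i => φ (fullMargin K J i) := by
  rw [segreIdeal_le_ker_iff]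
  constructor
  · intro h l i k
    by_cases hl : l ∈ J
    · simpa only [fullMargin, ← restrict_update] using h ⟨l, hl⟩ (fun j => i j) (fun j => k j)
    · simp only [fullMargin_update_of_notMem hl, mul_comm]
  · intro h l s t
    obtain ⟨i, rfl⟩ := exists_restrict_eq s
    obtain ⟨k, rfl⟩ := exists_restrict_eq t
    simpa only [fullMargin, restrict_update] using h l i k

theorem independenceIdeal_le_ker_iff (φ : F) (Δ : Set (Finset (Fin n))) :
    independenceIdeal K a Δ ≤ RingHom.ker φ ↔
      ∀ J ∈ Δ, IsSwap fun i => φ (fullMargin K J i) := by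
  simp only [independenceIdeal, iSup₂_le_iff, segreIdeal_margin_le_ker_iff]

theorem twoFacetIdeal_le_ker_iff (φ : F) (Δ : Set (Finset (Fin n)))
    (J₁ J₂ : Finset (Fin n)) (i₁ i₂ : Fin n) :
    twoFacetIdeal K a Δ J₁ J₂ i₁ i₂ ≤ RingHom.ker φ ↔
      (∀ J ∈ Δ, IsSwap fun i => φ (fullMargin K J i)) ∧
        (∀ i, φ (fullMargin K (J₁.erase i₁) i) = 0) ∧
          ∀ i, φ (fullMargin K (J₂.erase i₂) i) = 0 := by
  simp only [twoFacetIdeal, Submodule.add_eq_sup, sup_le_iff, independenceIdeal_le_ker_iff,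
    marginIdeal_le_ker_iff, and_assoc]

end Restrict

end FullMargin

theorem map_ker_comp_eq_span {A B C : Type*} [CommRing A] [CommRing B] [CommRing C]
    [Algebra K A] [Algebra K B] [Algebra K C] (s : B →ₐ[K] C) (f : A →ₐ[K] B) :
    (RingHom.ker (s.comp f)).map f = Ideal.span {x | x ∈ f.range ∧ s x = 0} := by
  rw [Ideal.map]
  congr 1
  ext x
  constructor
  · rintro ⟨y, hy, rfl⟩
    exact ⟨⟨y, rfl⟩, hy⟩
  · rintro ⟨⟨y, rfl⟩, hy⟩
    exact ⟨y, hy, rfl⟩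

section Facets

variable {Δ : Set (Finset (Fin n))}

theorem facets_subset : facets Δ ⊆ Δ := fun _ h => h.prop

theorem exists_mem_facets_of_mem {J : Finset (Fin n)} (hJ : J ∈ Δ) : ∃ M ∈ facets Δ, J ⊆ M := by
  obtain ⟨M, hJM, hM⟩ := (Set.toFinite Δ).exists_le_maximal hJ
  exact ⟨M, hM, hJM⟩

theorem sdiff_nonempty_of_mem_facets {J J' : Finset (Fin n)} (hJ : J ∈ facets Δ)
    (hJ' : J' ∈ facets Δ) (hne : J ≠ J') : (J \ J').Nonempty :=
  Finset.sdiff_nonempty.2 fun h => hne (Maximal.eq_of_le hJ hJ'.prop h)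

theorem fullMargin_mem_range_tau {J J' : Finset (Fin n)} (hJ' : J' ∈ Δ) (hJ : J ⊆ J')
    (i : (j : Fin n) → Fin (a j)) : fullMargin K J i ∈ (tau K a Δ).range := by
  induction hJ using induction_downward_insert generalizing i with
  | top => exact ⟨X ⟨⟨J', hJ'⟩, fun j => i j⟩, aeval_X _ _⟩
  | step J l hl _ ih =>
    rw [fullMargin_eq_sum_insert hl]
    exact sum_mem fun v _ => ih _

variable (K a Δ) in
theorem mainIdeal_eq_span :
    mainIdeal K a Δ = Ideal.span {f | f ∈ (tau K a Δ).range ∧ segreMap K a f = 0} :=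
  map_ker_comp_eq_span _ _

variable [∀ j, NeZero (a j)]

variable (K a Δ) in
theorem independenceIdeal_facets :
    independenceIdeal K a (facets Δ) = independenceIdeal K a Δ := by
  refine le_antisymm (biSup_mono facets_subset) ?_
  have hswap := (independenceIdeal_le_ker_iff _ _).1 (Ideal.mk_ker (I := independenceIdeal K a
    (facets Δ))).ge
  rw [← Ideal.mk_ker (I := independenceIdeal K a (facets Δ)), independenceIdeal_le_ker_iff]
  intro J hJ
  obtain ⟨M, hM, hJM⟩ := exists_mem_facets_of_mem hJ
  exact isSwap_fullMargin_mono _ hJM (hswap M hM)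

theorem range_tau_eq_adjoin :
    (tau K a Δ).range = Algebra.adjoin K {f | ∃ J ∈ Δ, ∃ i, f = fullMargin K J i} := by
  refine le_antisymm ?_ (Algebra.adjoin_le ?_)
  · rw [tau, ← Algebra.adjoin_range_eq_range_aeval]
    refine Algebra.adjoin_mono ?_
    rintro _ ⟨⟨⟨J, hJ⟩, s⟩, rfl⟩
    obtain ⟨i, rfl⟩ := exists_restrict_eq s
    exact ⟨J, hJ, i, rfl⟩
  · rintro _ ⟨J, hJ, i, rfl⟩
    exact fullMargin_mem_range_tau hJ subset_rfl i

variable (K a Δ) in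
theorem range_tau_facets : (tau K a (facets Δ)).range = (tau K a Δ).range := by
  simp only [range_tau_eq_adjoin]
  refine le_antisymm (Algebra.adjoin_mono ?_) (Algebra.adjoin_le ?_)
  · rintro _ ⟨J, hJ, i, rfl⟩
    exact ⟨J, facets_subset hJ, i, rfl⟩
  · rintro _ ⟨J, hJ, i, rfl⟩
    obtain ⟨M, hM, hJM⟩ := exists_mem_facets_of_mem hJ
    rw [← range_tau_eq_adjoin]
    exact fullMargin_mem_range_tau hM hJM i

variable (K a Δ) in
theorem mainIdeal_facets : mainIdeal K a (facets Δ) = mainIdeal K a Δ := by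
  rw [mainIdeal_eq_span, mainIdeal_eq_span, range_tau_facets]

end Facets

section ProductPoints

variable {E : Type*} [CommRing E] [Algebra K E]

/-- Evaluation of the generic table at the scaled product table `x_i = c ∏ j, y_{j,i_j}`; the
scalar makes room for the normalizations `∏ j ∉ J, ∑ v, y_{j,v} = c⁻¹`. -/
def productPoint (c : E) (y : (j : Fin n) → Fin (a j) → E) : TableRing K a →ₐ[K] E :=
  aeval fun i => c * ∏ j, y j (i j)

theorem productPoint_fullMargin (c : E) (y : (j : Fin n) → Fin (a j) → E) (J : Finset (Fin n))
    (i : (j : Fin n) → Fin (a j)) :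
    productPoint (K := K) c y (fullMargin K J i) =
      c * (∏ j ∈ J, y j (i j)) * ∏ j ∈ Jᶜ, ∑ v, y j v := by
  refine map_fullMargin_eq_prod (productPoint (K := K) c y) c (fun k => ?_)
    J.subset_univ i
  rw [fullMargin_univ]
  exact aeval_X _ _

theorem segreMap_eq_productPoint :
    segreMap K a = productPoint 1 fun j v => X ⟨j, v⟩ := by
  simp only [segreMap, productPoint, one_mul]

theorem isSwap_segreMap_fullMargin (J : Finset (Fin n)) :
    IsSwap fun i : (j : Fin n) → Fin (a j) => segreMap K a (fullMargin K J i) := by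
  intro l i k
  simp only [segreMap_eq_productPoint, productPoint_fullMargin, one_mul]
  linear_combination (∏ j ∈ Jᶜ, ∑ v, X ⟨j, v⟩) ^ 2 *
    isSwap_prod J (fun j v => (X ⟨j, v⟩ : MvPolynomial ((j : Fin n) × Fin (a j)) K)) l i k

variable (K a) in
theorem independenceIdeal_le_mainIdeal [∀ j, NeZero (a j)] (Δ : Set (Finset (Fin n))) :
    independenceIdeal K a Δ ≤ mainIdeal K a Δ := by
  rw [← Ideal.mk_ker (I := mainIdeal K a Δ), independenceIdeal_le_ker_iff]
  intro J hJ l i k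
  rw [← map_mul, ← map_mul, Ideal.Quotient.eq, mainIdeal_eq_span]
  refine Ideal.subset_span ⟨sub_mem (mul_mem ?_ ?_) (mul_mem ?_ ?_), ?_⟩
  any_goals exact fullMargin_mem_range_tau hJ subset_rfl _
  simpa only [map_sub, map_mul, sub_eq_zero] using isSwap_segreMap_fullMargin J l i k

theorem productPoint_eq_zero_of_segreMap_eq_zero [NeZero n] (c : E)
    (y : (j : Fin n) → Fin (a j) → E) {f : TableRing K a} (hf : segreMap K a f = 0) :
    productPoint c y f = 0 := by
  have factor : productPoint c y = (aeval fun p : (j : Fin n) × Fin (a j) =>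
      (Pi.mulSingle 0 c : Fin n → E) p.1 * y p.1 p.2).comp (segreMap K a) := by
    refine algHom_ext fun i => ?_
    simp [productPoint, segreMap, Finset.prod_mul_distrib]
  rw [factor, AlgHom.comp_apply, hf, map_zero]

theorem mainIdeal_le_ker_productPoint [NeZero n] (c : E) (y : (j : Fin n) → Fin (a j) → E)
    (Δ : Set (Finset (Fin n))) :
    mainIdeal K a Δ ≤ RingHom.ker (productPoint (K := K) c y) := by
  rw [mainIdeal_eq_span, Ideal.span_le]
  exact fun f hf => productPoint_eq_zero_of_segreMap_eq_zero c y hf.2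

/-- The point of the space of formal margins all of whose margins are the product tables
`∏ j ∈ J, w_{j,s_j}`, for one family of weights `w`. -/
def productMargins (Δ : Set (Finset (Fin n))) (w : (j : Fin n) → Fin (a j) → E) :
    MarginRing K a Δ →ₐ[K] E :=
  aeval fun p => ∏ j : p.1.1, w j (p.2 j)

theorem comp_productMargins {E' : Type*} [CommRing E'] [Algebra K E'] (g : E →ₐ[K] E')
    (Δ : Set (Finset (Fin n))) (w : (j : Fin n) → Fin (a j) → E) :
    g.comp (productMargins Δ w) = productMargins Δ fun j v => g (w j v) := by
  refine algHom_ext fun p => ?_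
  simp [productMargins]

theorem comp_tau_eq_productMargins [∀ j, NeZero (a j)] {Δ : Set (Finset (Fin n))}
    (φ : TableRing K a →ₐ[K] E) (w : (j : Fin n) → Fin (a j) → E)
    (h : ∀ J ∈ Δ, ∀ i, φ (fullMargin K J i) = ∏ j ∈ J, w j (i j)) :
    φ.comp (tau K a Δ) = productMargins Δ w := by
  refine algHom_ext ?_
  rintro ⟨⟨J, hJ⟩, s⟩
  obtain ⟨i, rfl⟩ := exists_restrict_eq s
  rw [AlgHom.comp_apply, tau, productMargins, aeval_X, aeval_X]
  exact (h J hJ i).trans (Finset.prod_coe_sort J fun j => w j (i j)).symm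

theorem ker_sigma_le_ker_productMargins_of_field [∀ j, NeZero (a j)] [NeZero n]
    {F : Type*} [Field F] [Algebra K F] {Δ : Set (Finset (Fin n))}
    (w : (j : Fin n) → Fin (a j) → F) {N : F} (hN : N ≠ 0)
    (h : ∀ J ∈ Δ, ∏ j ∈ Jᶜ, ∑ v, w j v = N) :
    RingHom.ker (sigma K a Δ) ≤ RingHom.ker (productMargins (K := K) Δ w) := by
  have factor : (productPoint N⁻¹ w).comp (tau K a Δ) = productMargins Δ w := by
    refine comp_tau_eq_productMargins _ _ fun J hJ i => ?_
    rw [productPoint_fullMargin, h J hJ]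
    field_simp
  intro f hf
  rw [RingHom.mem_ker, ← factor, AlgHom.comp_apply]
  exact productPoint_eq_zero_of_segreMap_eq_zero _ _ hf

theorem ker_sigma_le_ker_productMargins_of_ne_zero [IsDomain E] [∀ j, NeZero (a j)] [NeZero n]
    {Δ : Set (Finset (Fin n))} (w : (j : Fin n) → Fin (a j) → E) {N : E} (hN : N ≠ 0)
    (h : ∀ J ∈ Δ, ∏ j ∈ Jᶜ, ∑ v, w j v = N) :
    RingHom.ker (sigma K a Δ) ≤ RingHom.ker (productMargins (K := K) Δ w) := by
  have inj : Injective (IsScalarTower.toAlgHom K E (FractionRing E)) :=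
    IsFractionRing.injective E (FractionRing E)
  have hker := ker_sigma_le_ker_productMargins_of_field (K := K) (Δ := Δ)
    (fun j v => IsScalarTower.toAlgHom K E (FractionRing E) (w j v)) ((map_ne_zero_iff _ inj).2 hN)
    fun J hJ => by simp only [← map_sum, ← map_prod, h J hJ]
  rw [← comp_productMargins] at hker
  exact fun f hf => (map_eq_zero_iff _ inj).1 (hker hf)

end ProductPoints

section Deformation

open Polynomial in
theorem exists_polynomial_prod_eq_prod {ι E : Type*} [CommRing E] [IsDomain E]
    {A B : Finset ι} (hAB : Disjoint A B) {s : ι → E} (h : ∏ j ∈ A, s j = ∏ j ∈ B, s j) :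
    ∃ S : ι → E[X], (∀ j, (S j).eval 0 = s j) ∧ (∀ j, S j ≠ 0) ∧
      ∏ j ∈ A, S j = ∏ j ∈ B, S j := by
  classical
  by_cases h0 : ∏ j ∈ A, s j = 0
  · obtain ⟨i₁, hi₁, hs₁⟩ := Finset.prod_eq_zero_iff.1 h0
    obtain ⟨i₂, hi₂, hs₂⟩ := Finset.prod_eq_zero_iff.1 (h.symm.trans h0)
    let T : ι → E[X] := fun j => .X + .C (s j)
    have hT : ∀ J : Finset ι, (.X : E[X]) * ∏ j ∈ J, T j ≠ 0 := fun J =>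
      mul_ne_zero Polynomial.X_ne_zero
        (Finset.prod_ne_zero_iff.2 fun j _ => Polynomial.X_add_C_ne_zero _)
    refine ⟨update (update T i₁ (.X * ∏ j ∈ B.erase i₂, T j)) i₂ (.X * ∏ j ∈ A.erase i₁, T j),
      fun j => ?_, fun j => ?_, ?_⟩
    · simp only [update_apply]
      split_ifs with h₂ h₁ <;> simp [*, T]
    · simp only [update_apply]
      split_ifs
      exacts [hT _, hT _, Polynomial.X_add_C_ne_zero _]
    · have hi₁B : i₁ ∉ B := Finset.disjoint_left.1 hAB hi₁
      have hi₂A : i₂ ∉ A := Finset.disjoint_right.1 hAB hi₂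
      rw [Finset.prod_update_of_notMem hi₂A, Finset.prod_update_of_mem hi₁,
        Finset.prod_update_of_mem hi₂, ← Finset.erase_eq, ← Finset.erase_eq,
        Finset.prod_update_of_notMem fun hi => hi₁B (Finset.mem_of_mem_erase hi)]
      ring
  · refine ⟨fun j => if j ∈ A ∪ B then .C (s j) else .X + .C (s j), fun j => ?_, fun j => ?_, ?_⟩
    · dsimp only
      split_ifs <;> simp
    · dsimp only
      split_ifs with hj
      · rw [Polynomial.C_ne_zero]
        rcases Finset.mem_union.1 hj with hj | hj
        exacts [Finset.prod_ne_zero_iff.1 h0 j hj, Finset.prod_ne_zero_iff.1 (h ▸ h0) j hj]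
      · exact Polynomial.X_add_C_ne_zero _
    · have prod_C : ∀ J ⊆ A ∪ B, ∏ j ∈ J, (if j ∈ A ∪ B then .C (s j) else .X + .C (s j) : E[X]) =
          .C (∏ j ∈ J, s j) := fun J hJ => by
        rw [map_prod]
        exact Finset.prod_congr rfl fun j hj => if_pos (hJ hj)
      rw [prod_C A Finset.subset_union_left, prod_C B Finset.subset_union_right, h]

theorem ker_sigma_le_ker_productMargins [∀ j, NeZero (a j)] [NeZero n]
    {E : Type*} [CommRing E] [IsDomain E] [Algebra K E] {J₁ J₂ : Finset (Fin n)}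
    (w : (j : Fin n) → Fin (a j) → E)
    (h : ∏ j ∈ J₁ \ J₂, ∑ v, w j v = ∏ j ∈ J₂ \ J₁, ∑ v, w j v) :
    RingHom.ker (sigma K a {J₁, J₂}) ≤ RingHom.ker (productMargins (K := K) {J₁, J₂} w) := by
  obtain ⟨S, hS_eval, hS_ne, hS⟩ := exists_polynomial_prod_eq_prod
    (disjoint_sdiff_sdiff (x := J₁) (y := J₂)) h
  let W : (j : Fin n) → Fin (a j) → Polynomial E := fun j v =>
    .C (w j v) + if v = 0 then S j - .C (∑ v, w j v) else 0
  have sum_W : ∀ j, ∑ v, W j v = S j := fun j => by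
    simp [W, Finset.sum_add_distrib]
  have eval_W : ∀ j v, (W j v).eval 0 = w j v := fun j v => by
    by_cases hv : v = 0
    · subst hv
      simp only [W, if_true, Polynomial.eval_add, Polynomial.eval_sub, Polynomial.eval_C, hS_eval]
      ring
    · simp [W, hv]
  have prod_S : ∏ j ∈ J₂ᶜ, S j = ∏ j ∈ J₁ᶜ, S j := by
    rw [← Finset.prod_inter_mul_prod_sdiff J₂ᶜ J₁ᶜ, ← Finset.prod_inter_mul_prod_sdiff J₁ᶜ J₂ᶜ,
      compl_sdiff_compl, compl_sdiff_compl, hS, Finset.inter_comm]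
  have hker := ker_sigma_le_ker_productMargins_of_ne_zero (K := K) (Δ := {J₁, J₂}) W
    (Finset.prod_ne_zero_iff.2 fun j (_ : j ∈ J₁ᶜ) => hS_ne j) <| by
      rintro J (rfl | rfl) <;> simp only [sum_W, prod_S]
  have specialize_W : productMargins {J₁, J₂} w =
      ((Polynomial.aeval (0 : E)).restrictScalars K).comp (productMargins {J₁, J₂} W) := by
    simp [comp_productMargins, Polynomial.coe_aeval_eq_eval, eval_W]
  intro f hf
  rw [RingHom.mem_ker, specialize_W, AlgHom.comp_apply, hker hf, map_zero]

theorem mainIdeal_le_ker_of_eq_prod [∀ j, NeZero (a j)] [NeZero n]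
    {E : Type*} [CommRing E] [IsDomain E] [Algebra K E] {J₁ J₂ : Finset (Fin n)}
    (φ : TableRing K a →ₐ[K] E) (w : (j : Fin n) → Fin (a j) → E)
    (h₁ : ∀ i, φ (fullMargin K J₁ i) = ∏ j ∈ J₁, w j (i j))
    (h₂ : ∀ i, φ (fullMargin K J₂ i) = ∏ j ∈ J₂, w j (i j))
    (h : ∏ j ∈ J₁ \ J₂, ∑ v, w j v = ∏ j ∈ J₂ \ J₁, ∑ v, w j v) :
    mainIdeal K a {J₁, J₂} ≤ RingHom.ker φ := by
  have factor : φ.comp (tau K a {J₁, J₂}) = productMargins {J₁, J₂} w :=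
    comp_tau_eq_productMargins φ w <| by
      rintro J (rfl | rfl)
      exacts [h₁, h₂]
  rw [mainIdeal, Ideal.map_le_iff_le_comap]
  intro f hf
  have hwf := ker_sigma_le_ker_productMargins w h hf
  rwa [RingHom.mem_ker, ← factor] at hwf

theorem mainIdeal_le_ker_of_eq_mul_prod [∀ j, NeZero (a j)]
    {E : Type*} [CommRing E] [IsDomain E] [Algebra K E] {J₁ J₂ : Finset (Fin n)}
    (hne₁ : (J₁ \ J₂).Nonempty) (hne₂ : (J₂ \ J₁).Nonempty)
    (φ : TableRing K a →ₐ[K] E) {u v : (j : Fin n) → Fin (a j) → E} {c₁ c₂ : E}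
    (h₁ : ∀ i, φ (fullMargin K J₁ i) = c₁ * ∏ j ∈ J₁, u j (i j))
    (h₂ : ∀ i, φ (fullMargin K J₂ i) = c₂ * ∏ j ∈ J₂, v j (i j))
    (huv : ∀ j ∈ J₁ ∩ J₂, u j = v j)
    (h : c₁ * ∏ j ∈ J₁ \ J₂, ∑ x, u j x = c₂ * ∏ j ∈ J₂ \ J₁, ∑ x, v j x) :
    mainIdeal K a {J₁, J₂} ≤ RingHom.ker φ := by
  obtain ⟨d₁, hd₁⟩ := hne₁
  have : NeZero n := .of_pos d₁.pos
  obtain ⟨d₂, hd₂⟩ := hne₂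
  have hd₁' := Finset.mem_sdiff.1 hd₁
  have hd₂' := Finset.mem_sdiff.1 hd₂
  have prod_scaled : ∀ {J : Finset (Fin n)} {d : Fin n} (c : E) (f : Fin n → E), d ∈ J →
      ∏ j ∈ J, (Pi.mulSingle d c : Fin n → E) j * f j = c * ∏ j ∈ J, f j := fun c f hd => by
    rw [Finset.prod_mul_distrib, Finset.prod_pi_mulSingle', if_pos hd]
  let w : (j : Fin n) → Fin (a j) → E := fun j x =>
    if j ∈ J₁ then (Pi.mulSingle d₁ c₁ : Fin n → E) j * u j x
    else (Pi.mulSingle d₂ c₂ : Fin n → E) j * v j x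
  have w_of_mem₁ : ∀ j ∈ J₁, ∀ x, w j x = (Pi.mulSingle d₁ c₁ : Fin n → E) j * u j x :=
    fun j hj x => if_pos hj
  have w_of_mem₂ : ∀ j ∈ J₂, ∀ x, w j x = (Pi.mulSingle d₂ c₂ : Fin n → E) j * v j x := by
    intro j hj x
    by_cases hj₁ : j ∈ J₁
    · rw [w_of_mem₁ j hj₁, huv j (Finset.mem_inter.2 ⟨hj₁, hj⟩),
        Pi.mulSingle_eq_of_ne (ne_of_mem_of_not_mem hj hd₁'.2),
        Pi.mulSingle_eq_of_ne (ne_of_mem_of_not_mem hj₁ hd₂'.2)]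
    · exact if_neg hj₁
  refine mainIdeal_le_ker_of_eq_prod φ w (fun i => ?_) (fun i => ?_) ?_
  · rw [h₁, Finset.prod_congr rfl fun j hj => w_of_mem₁ j hj _, prod_scaled _ _ hd₁'.1]
  · rw [h₂, Finset.prod_congr rfl fun j hj => w_of_mem₂ j hj _, prod_scaled _ _ hd₂'.1]
  · have sum_w₁ : ∀ j ∈ J₁ \ J₂, ∑ x, w j x = (Pi.mulSingle d₁ c₁ : Fin n → E) j * ∑ x, u j x :=
      fun j hj => by simp only [w_of_mem₁ j (Finset.mem_sdiff.1 hj).1, Finset.mul_sum]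
    have sum_w₂ : ∀ j ∈ J₂ \ J₁, ∑ x, w j x = (Pi.mulSingle d₂ c₂ : Fin n → E) j * ∑ x, v j x :=
      fun j hj => by simp only [w_of_mem₂ j (Finset.mem_sdiff.1 hj).1, Finset.mul_sum]
    rw [Finset.prod_congr rfl sum_w₁, Finset.prod_congr rfl sum_w₂, prod_scaled _ _ hd₁,
      prod_scaled _ _ hd₂, h]

end Deformation

section NormalizedFactorization

variable {F : Type*} [Field F] [Algebra K F] {φ : TableRing K a →ₐ[K] F} {J C : Finset (Fin n)}
  {s : (j : Fin n) → Fin (a j)}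

theorem exists_map_fullMargin_eq_mul_prod (hswap : IsSwap fun i => φ (fullMargin K J i))
    (hs : φ (fullMargin K J s) ≠ 0) :
    ∃ w : (j : Fin n) → Fin (a j) → F, (∀ j, w j (s j) = 1) ∧
      ∀ i, φ (fullMargin K J i) = φ (fullMargin K J s) * ∏ j ∈ J, w j (i j) :=
  hswap.exists_eq_mul_prod (fun _ _ h => congrArg φ (dependsOn_fullMargin J h)) hs

variable {w : (j : Fin n) → Fin (a j) → F}

theorem map_fullMargin_base (hw_one : ∀ j, w j (s j) = 1)
    (hw : ∀ i, φ (fullMargin K J i) = φ (fullMargin K J s) * ∏ j ∈ J, w j (i j)) (hC : C ⊆ J) :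
    φ (fullMargin K C s) = φ (fullMargin K J s) * ∏ j ∈ J \ C, ∑ x, w j x := by
  rw [map_fullMargin_eq_prod φ _ hw hC]
  simp only [hw_one, Finset.prod_const_one, mul_one]

theorem map_fullMargin_update_base (hw_one : ∀ j, w j (s j) = 1)
    (hw : ∀ i, φ (fullMargin K J i) = φ (fullMargin K J s) * ∏ j ∈ J, w j (i j)) (hC : C ⊆ J)
    {l : Fin n} (hl : l ∈ C) (x : Fin (a l)) :
    φ (fullMargin K C (update s l x)) = φ (fullMargin K C s) * w l x := by
  have prod_update : ∏ j ∈ C, w j (update s l x j) = w l x := by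
    rw [Finset.prod_eq_single_of_mem l hl fun j _ hj => by rw [update_of_ne hj, hw_one],
      update_self]
  rw [map_fullMargin_base hw_one hw hC, map_fullMargin_eq_prod φ _ hw hC, prod_update]
  ring

end NormalizedFactorization

section Dichotomy

variable {J₁ J₂ : Finset (Fin n)} {F : Type*} [Field F] [Algebra K F]
  {φ : TableRing K a →ₐ[K] F}

theorem exists_common_ne_zero {s : (j : Fin n) → Fin (a j)}
    (hs : φ (fullMargin K (J₁ ∩ J₂) s) ≠ 0) :
    ∃ t, φ (fullMargin K J₁ t) ≠ 0 ∧ φ (fullMargin K J₂ t) ≠ 0 ∧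
      φ (fullMargin K (J₁ ∩ J₂) t) ≠ 0 := by
  have extend : ∀ {J}, J₁ ∩ J₂ ⊆ J →
      ∃ k, (∀ j ∈ J₁ ∩ J₂, k j = s j) ∧ φ (fullMargin K J k) ≠ 0 := fun hJ => by
    by_contra! h
    exact hs (map_fullMargin_eq_zero φ hJ s h)
  obtain ⟨k₁, hk₁s, hk₁⟩ := extend Finset.inter_subset_left
  obtain ⟨k₂, hk₂s, hk₂⟩ := extend Finset.inter_subset_right
  have piecewise_eq₁ : ∀ j ∈ J₁, J₁.piecewise k₁ k₂ j = k₁ j := fun j hj =>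
    J₁.piecewise_eq_of_mem _ _ hj
  have piecewise_eq₂ : ∀ j ∈ J₂, J₁.piecewise k₁ k₂ j = k₂ j := fun j hj => by
    by_cases hj₁ : j ∈ J₁
    · rw [piecewise_eq₁ j hj₁, hk₁s j (Finset.mem_inter.2 ⟨hj₁, hj⟩),
        hk₂s j (Finset.mem_inter.2 ⟨hj₁, hj⟩)]
    · exact J₁.piecewise_eq_of_notMem _ _ hj₁
  refine ⟨J₁.piecewise k₁ k₂, ?_, ?_, ?_⟩
  · rwa [dependsOn_fullMargin J₁ piecewise_eq₁]
  · rwa [dependsOn_fullMargin J₂ piecewise_eq₂]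
  · rwa [dependsOn_fullMargin (J₁ ∩ J₂) fun j hj =>
      (piecewise_eq₁ j (Finset.mem_inter.1 hj).1).trans (hk₁s j hj)]

theorem exists_fullMargin_erase_eq_zero {J C : Finset (Fin n)}
    (hswap : IsSwap fun i => φ (fullMargin K J i)) (hne : (J \ C).Nonempty) (hC : C ⊆ J)
    (h0 : ∀ i, φ (fullMargin K C i) = 0) :
    ∃ l ∈ J \ C, ∀ i, φ (fullMargin K (J.erase l) i) = 0 := by
  by_cases hJ : ∀ i, φ (fullMargin K J i) = 0
  · obtain ⟨l, hl⟩ := hne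
    exact ⟨l, hl, fun i => map_fullMargin_eq_zero φ (J.erase_subset l) i fun k _ => hJ k⟩
  · push Not at hJ
    obtain ⟨s, hs⟩ := hJ
    obtain ⟨w, hw_one, hw⟩ := exists_map_fullMargin_eq_mul_prod hswap hs
    have hprod : ∏ j ∈ J \ C, ∑ x, w j x = 0 := by
      simpa only [h0, zero_eq_mul, hs, false_or] using map_fullMargin_base hw_one hw hC
    obtain ⟨l, hl, hsum⟩ := Finset.prod_eq_zero_iff.1 hprod
    refine ⟨l, hl, fun i => ?_⟩
    rw [map_fullMargin_eq_prod φ _ hw (J.erase_subset l),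
      Finset.sdiff_erase_self (Finset.mem_sdiff.1 hl).1, Finset.prod_singleton, hsum, mul_zero]

theorem map_fullMargin_eq_zero_of_erase {J : Finset (Fin n)} {l : Fin n} [Subsingleton (Fin (a l))]
    (h : ∀ i, φ (fullMargin K (J.erase l) i) = 0) (i : (j : Fin n) → Fin (a j)) :
    φ (fullMargin K J i) = 0 := by
  by_cases hl : l ∈ J
  · have hi := h i
    rwa [fullMargin_eq_sum_insert (Finset.notMem_erase l J), Finset.insert_erase hl,
      Fintype.sum_subsingleton _ (i l), update_eq_self] at hi
  · rw [← h i, Finset.erase_eq_of_notMem hl]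

variable [∀ j, NeZero (a j)]

theorem mainIdeal_le_ker_of_fullMargin_eq_zero (hne₁ : (J₁ \ J₂).Nonempty)
    (hne₂ : (J₂ \ J₁).Nonempty) (h₁ : ∀ i, φ (fullMargin K J₁ i) = 0)
    (hswap₂ : IsSwap fun i => φ (fullMargin K J₂ i)) :
    mainIdeal K a {J₁, J₂} ≤ RingHom.ker φ := by
  by_cases h₂ : ∀ i, φ (fullMargin K J₂ i) = 0
  · exact mainIdeal_le_ker_of_eq_mul_prod (u := 1) (v := 1) hne₁ hne₂ φ
      (fun i => by rw [h₁, zero_mul]) (fun i => by rw [h₂, zero_mul]) (fun _ _ => rfl)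
      (by simp only [zero_mul])
  · push Not at h₂
    obtain ⟨s, hs⟩ := h₂
    obtain ⟨v, hv_one, hv⟩ := exists_map_fullMargin_eq_mul_prod hswap₂ hs
    refine mainIdeal_le_ker_of_eq_mul_prod hne₁ hne₂ φ (fun i => by rw [h₁, zero_mul]) hv
      (fun _ _ => rfl) ?_
    rw [← Finset.sdiff_inter_self_right J₂,
      ← map_fullMargin_base hv_one hv Finset.inter_subset_right, zero_mul,
      map_fullMargin_eq_zero φ Finset.inter_subset_left s fun k _ => h₁ k]

theorem mainIdeal_le_ker_of_fullMargin_inter_ne_zero (hne₁ : (J₁ \ J₂).Nonempty)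
    (hne₂ : (J₂ \ J₁).Nonempty) (hswap₁ : IsSwap fun i => φ (fullMargin K J₁ i))
    (hswap₂ : IsSwap fun i => φ (fullMargin K J₂ i)) {s : (j : Fin n) → Fin (a j)}
    (hs : φ (fullMargin K (J₁ ∩ J₂) s) ≠ 0) :
    mainIdeal K a {J₁, J₂} ≤ RingHom.ker φ := by
  obtain ⟨t, ht₁, ht₂, ht⟩ := exists_common_ne_zero hs
  obtain ⟨u, hu_one, hu⟩ := exists_map_fullMargin_eq_mul_prod hswap₁ ht₁
  obtain ⟨v, hv_one, hv⟩ := exists_map_fullMargin_eq_mul_prod hswap₂ ht₂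
  refine mainIdeal_le_ker_of_eq_mul_prod hne₁ hne₂ φ hu hv (fun j hj => funext fun x => ?_) ?_
  · rw [← mul_right_inj' ht,
      ← map_fullMargin_update_base hu_one hu Finset.inter_subset_left hj,
      ← map_fullMargin_update_base hv_one hv Finset.inter_subset_right hj]
  · rw [← Finset.sdiff_inter_self_left, ← Finset.sdiff_inter_self_right J₂,
      ← map_fullMargin_base hu_one hu Finset.inter_subset_left,
      ← map_fullMargin_base hv_one hv Finset.inter_subset_right]

theorem mainIdeal_le_ker_of_subsingleton_inter (hne₁ : (J₁ \ J₂).Nonempty)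
    (hne₂ : (J₂ \ J₁).Nonempty) (hswap₁ : IsSwap fun i => φ (fullMargin K J₁ i))
    (hswap₂ : IsSwap fun i => φ (fullMargin K J₂ i))
    (hsub : ∀ c ∈ J₁ ∩ J₂, Subsingleton (Fin (a c))) :
    mainIdeal K a {J₁, J₂} ≤ RingHom.ker φ := by
  by_cases h₁ : ∀ i, φ (fullMargin K J₁ i) = 0
  · exact mainIdeal_le_ker_of_fullMargin_eq_zero hne₁ hne₂ h₁ hswap₂
  by_cases h₂ : ∀ i, φ (fullMargin K J₂ i) = 0
  · rw [Set.pair_comm]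
    exact mainIdeal_le_ker_of_fullMargin_eq_zero hne₂ hne₁ h₂ hswap₁
  push Not at h₁ h₂
  obtain ⟨s, hs⟩ := h₁
  obtain ⟨t, ht⟩ := h₂
  obtain ⟨u, hu_one, hu⟩ := exists_map_fullMargin_eq_mul_prod hswap₁ hs
  obtain ⟨v, hv_one, hv⟩ := exists_map_fullMargin_eq_mul_prod hswap₂ ht
  refine mainIdeal_le_ker_of_eq_mul_prod hne₁ hne₂ φ hu hv (fun j hj => funext fun x => ?_) ?_
  · have := hsub j hj
    rw [Subsingleton.elim x (s j), hu_one, Subsingleton.elim (s j) (t j), hv_one]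
  · rw [← Finset.sdiff_inter_self_left, ← Finset.sdiff_inter_self_right J₂,
      ← map_fullMargin_base hu_one hu Finset.inter_subset_left,
      ← map_fullMargin_base hv_one hv Finset.inter_subset_right]
    exact congrArg φ (dependsOn_fullMargin _ fun j hj => (hsub j hj).elim _ _)

theorem mainIdeal_le_or_exists_twoFacetIdeal_le (hne₁ : (J₁ \ J₂).Nonempty)
    (hne₂ : (J₂ \ J₁).Nonempty) {q : Ideal (TableRing K a)} [q.IsPrime]
    (hq : independenceIdeal K a {J₁, J₂} ≤ q) :
    mainIdeal K a {J₁, J₂} ≤ q ∨ ∃ i₁ ∈ J₁ \ J₂, ∃ i₂ ∈ J₂ \ J₁,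
      (2 ≤ a i₁ ∧ 2 ≤ a i₂ ∧ ∃ c ∈ J₁ ∩ J₂, 2 ≤ a c) ∧
        twoFacetIdeal K a {J₁, J₂} J₁ J₂ i₁ i₂ ≤ q := by
  let φ := IsScalarTower.toAlgHom K (TableRing K a) q.ResidueField
  have ker_φ : RingHom.ker φ = q := q.ker_algebraMap_residueField
  have subsingleton_of_lt : ∀ {j}, ¬ 2 ≤ a j → Subsingleton (Fin (a j)) := fun h =>
    Fin.subsingleton_iff_le_one.2 (by omega)
  rw [← ker_φ] at hq ⊢
  have hswap := (independenceIdeal_le_ker_iff φ _).1 hq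
  have hswap₁ := hswap J₁ (Set.mem_insert _ _)
  have hswap₂ := hswap J₂ (Set.mem_insert_of_mem _ rfl)
  by_cases hC : ∀ i, φ (fullMargin K (J₁ ∩ J₂) i) = 0
  · obtain ⟨i₁, hi₁, h₁⟩ := exists_fullMargin_erase_eq_zero hswap₁
      (by rwa [Finset.sdiff_inter_self_left]) Finset.inter_subset_left hC
    obtain ⟨i₂, hi₂, h₂⟩ := exists_fullMargin_erase_eq_zero hswap₂
      (by rwa [Finset.sdiff_inter_self_right]) Finset.inter_subset_right hC
    rw [Finset.sdiff_inter_self_left] at hi₁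
    rw [Finset.sdiff_inter_self_right] at hi₂
    refine or_iff_not_imp_left.2 fun hP => ⟨i₁, hi₁, i₂, hi₂, ⟨?_, ?_, ?_⟩,
      (twoFacetIdeal_le_ker_iff φ _ _ _ _ _).2 ⟨hswap, h₁, h₂⟩⟩ <;> by_contra h
    · have := subsingleton_of_lt h
      exact hP (mainIdeal_le_ker_of_fullMargin_eq_zero hne₁ hne₂
        (map_fullMargin_eq_zero_of_erase h₁) hswap₂)
    · have := subsingleton_of_lt h
      rw [Set.pair_comm] at hP
      exact hP (mainIdeal_le_ker_of_fullMargin_eq_zero hne₂ hne₁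
        (map_fullMargin_eq_zero_of_erase h₂) hswap₁)
    · push Not at h
      exact hP (mainIdeal_le_ker_of_subsingleton_inter hne₁ hne₂ hswap₁ hswap₂
        fun c hc => subsingleton_of_lt (h c hc).not_ge)
  · push Not at hC
    obtain ⟨s, hs⟩ := hC
    exact Or.inl (mainIdeal_le_ker_of_fullMargin_inter_ne_zero hne₁ hne₂ hswap₁ hswap₂ hs)

end Dichotomy

theorem mixedMinor_mem_mainIdeal [∀ j, NeZero (a j)] {Δ : Set (Finset (Fin n))}
    {J J' : Finset (Fin n)} (hJ : J ∈ Δ) (hJ' : J' ∈ Δ) {l : Fin n} (hl : l ∈ J) (hl' : l ∈ J')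
    (i k : (j : Fin n) → Fin (a j)) :
    fullMargin K J i * fullMargin K J' k -
      fullMargin K J (update i l (k l)) * fullMargin K J' (update k l (i l)) ∈
        mainIdeal K a Δ := by
  have prod_update : ∀ (J : Finset (Fin n)) (i : (j : Fin n) → Fin (a j)) (v : Fin (a l)), l ∈ J →
      ∏ j ∈ J, (X ⟨j, update i l v j⟩ : MvPolynomial ((j : Fin n) × Fin (a j)) K) =
        X ⟨l, v⟩ * ∏ j ∈ J.erase l, X ⟨j, i j⟩ := fun J i v hl => by
    rw [← Finset.mul_prod_erase _ _ hl, update_self]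
    congr 1
    exact Finset.prod_congr rfl fun j hj => by rw [update_of_ne (Finset.ne_of_mem_erase hj)]
  rw [mainIdeal_eq_span]
  refine Ideal.subset_span ⟨sub_mem (mul_mem ?_ ?_) (mul_mem ?_ ?_), ?_⟩
  any_goals apply fullMargin_mem_range_tau ‹_› subset_rfl
  simp only [map_sub, map_mul, segreMap_eq_productPoint, productPoint_fullMargin]
  rw [prod_update J i _ hl, prod_update J' k _ hl', ← Finset.mul_prod_erase J _ hl,
    ← Finset.mul_prod_erase J' _ hl']
  ring

theorem not_marginIdeal_le_mainIdeal [∀ j, NeZero (a j)] [NeZero n] (J : Finset (Fin n))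
    (Δ : Set (Finset (Fin n))) : ¬ marginIdeal K a J ≤ mainIdeal K a Δ := by
  intro h
  have h0 := (marginIdeal_le_ker_iff _ J).1
    (h.trans (mainIdeal_le_ker_productPoint (1 : K) (fun _ => Pi.single 0 1) Δ)) 0
  simp [productPoint_fullMargin] at h0

section TwoTermPoints

variable {E : Type*} [CommRing E] [Algebra K E]

/-- Evaluation of the generic table at the sum of two product tables. For suitable `u` and `v`
this is a general point of the zero set of `Q_{i₁,i₂}`. -/
def twoTermPoint (u v : (j : Fin n) → Fin (a j) → E) : TableRing K a →ₐ[K] E :=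
  aeval fun i => ∏ j, u j (i j) + ∏ j, v j (i j)

theorem twoTermPoint_comm (u v : (j : Fin n) → Fin (a j) → E) :
    twoTermPoint (K := K) u v = twoTermPoint v u := by
  simp only [twoTermPoint, add_comm]

theorem twoTermPoint_fullMargin (u v : (j : Fin n) → Fin (a j) → E) (J : Finset (Fin n))
    (i : (j : Fin n) → Fin (a j)) :
    twoTermPoint (K := K) u v (fullMargin K J i) =
      (∏ j ∈ J, u j (i j)) * (∏ j ∈ Jᶜ, ∑ x, u j x) +
        (∏ j ∈ J, v j (i j)) * ∏ j ∈ Jᶜ, ∑ x, v j x := by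
  have hu := productPoint_fullMargin (K := K) 1 u J i
  have hv := productPoint_fullMargin (K := K) 1 v J i
  rw [one_mul] at hu hv
  rw [← hu, ← hv]
  simp only [fullMargin_eq, map_sum, twoTermPoint, productPoint, aeval_X, one_mul,
    Finset.sum_add_distrib]

theorem twoTermPoint_fullMargin_eq_zero {u v : (j : Fin n) → Fin (a j) → E} {i₁ i₂ : Fin n}
    (hu : ∑ x, u i₁ x = 0) (hv : ∑ x, v i₂ x = 0) {J : Finset (Fin n)} (h₁ : i₁ ∉ J)
    (h₂ : i₂ ∉ J) (i : (j : Fin n) → Fin (a j)) :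
    twoTermPoint (K := K) u v (fullMargin K J i) = 0 := by
  rw [twoTermPoint_fullMargin, Finset.prod_eq_zero (Finset.mem_compl.2 h₁) hu,
    Finset.prod_eq_zero (Finset.mem_compl.2 h₂) hv, mul_zero, mul_zero, add_zero]

theorem twoTermPoint_fullMargin_left {u v : (j : Fin n) → Fin (a j) → E} {i₁ i₂ : Fin n}
    (hu : ∀ j ≠ i₁, ∑ x, u j x = 1) (hv : ∑ x, v i₂ x = 0) {J : Finset (Fin n)} (h₁ : i₁ ∈ J)
    (h₂ : i₂ ∉ J) (i : (j : Fin n) → Fin (a j)) :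
    twoTermPoint (K := K) u v (fullMargin K J i) = ∏ j ∈ J, u j (i j) := by
  have sum_u : ∀ j ∈ Jᶜ, ∑ x, u j x = 1 := fun j hj =>
    hu j (ne_of_mem_of_not_mem h₁ (Finset.mem_compl.1 hj)).symm
  rw [twoTermPoint_fullMargin, Finset.prod_eq_one sum_u,
    Finset.prod_eq_zero (Finset.mem_compl.2 h₂) hv, mul_one, mul_zero, add_zero]

theorem twoTermPoint_fullMargin_right {u v : (j : Fin n) → Fin (a j) → E} {i₁ i₂ : Fin n}
    (hu : ∑ x, u i₁ x = 0) (hv : ∀ j ≠ i₂, ∑ x, v j x = 1) {J : Finset (Fin n)} (h₁ : i₁ ∉ J)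
    (h₂ : i₂ ∈ J) (i : (j : Fin n) → Fin (a j)) :
    twoTermPoint (K := K) u v (fullMargin K J i) = ∏ j ∈ J, v j (i j) := by
  rw [twoTermPoint_comm, twoTermPoint_fullMargin_left hv hu h₂ h₁]

theorem exists_family_sum_eq_zero (t : (j : Fin n) → Fin (a j)) {d : Fin n} (hd : 2 ≤ a d) :
    ∃ u : (j : Fin n) → Fin (a j) → E, (∀ j ≠ d, u j = Pi.single (t j) 1) ∧
      (∀ j, u j (t j) = 1) ∧ ∑ x, u d x = 0 := by
  have : Nontrivial (Fin (a d)) := Fin.nontrivial_iff_two_le.2 hd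
  obtain ⟨r, hr⟩ := exists_ne (t d)
  refine ⟨update (fun j => Pi.single (t j) 1) d (Pi.single (t d) 1 - Pi.single r 1),
    fun j hj => update_of_ne hj _ _, fun j => ?_, by simp⟩
  obtain rfl | hj := eq_or_ne j d
  · simp [hr.symm]
  · simp [update_of_ne hj]

end TwoTermPoints

section Antichain

variable [∀ j, NeZero (a j)] {J₁ J₂ : Finset (Fin n)} {i₁ i₂ : Fin n}

theorem twoFacetIdeal_le_ker_twoTermPoint {E : Type*} [CommRing E] [Algebra K E]
    {u v : (j : Fin n) → Fin (a j) → E} (hu : ∀ j ≠ i₁, ∑ x, u j x = 1) (hu₀ : ∑ x, u i₁ x = 0)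
    (hv : ∀ j ≠ i₂, ∑ x, v j x = 1) (hv₀ : ∑ x, v i₂ x = 0) (hi₁ : i₁ ∈ J₁ \ J₂)
    (hi₂ : i₂ ∈ J₂ \ J₁) :
    twoFacetIdeal K a {J₁, J₂} J₁ J₂ i₁ i₂ ≤ RingHom.ker (twoTermPoint (K := K) u v) := by
  rw [Finset.mem_sdiff] at hi₁ hi₂
  refine (twoFacetIdeal_le_ker_iff _ _ _ _ _ _).2 ⟨?_, ?_, ?_⟩
  · rintro J (rfl | rfl)
    · simpa only [twoTermPoint_fullMargin_left hu hv₀ hi₁.1 hi₂.2] using isSwap_prod J u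
    · simpa only [twoTermPoint_fullMargin_right hu₀ hv hi₁.2 hi₂.1] using isSwap_prod J v
  · exact twoTermPoint_fullMargin_eq_zero hu₀ hv₀ (Finset.notMem_erase _ _)
      fun h => hi₂.2 (Finset.mem_of_mem_erase h)
  · exact twoTermPoint_fullMargin_eq_zero hu₀ hv₀ (fun h => hi₁.2 (Finset.mem_of_mem_erase h))
      (Finset.notMem_erase _ _)

variable (K) in
theorem exists_twoFacetIdeal_le_ker (h₁ : 2 ≤ a i₁) (h₂ : 2 ≤ a i₂) (hi₁ : i₁ ∈ J₁ \ J₂)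
    (hi₂ : i₂ ∈ J₂ \ J₁) (s t : (j : Fin n) → Fin (a j)) :
    ∃ φ : TableRing K a →ₐ[K] K,
      twoFacetIdeal K a {J₁, J₂} J₁ J₂ i₁ i₂ ≤ RingHom.ker φ ∧
      (∀ J, i₁ ∈ J → i₂ ∉ J → φ (fullMargin K J s) = 1) ∧
      (∀ J, i₁ ∉ J → i₂ ∈ J → φ (fullMargin K J t) = 1) ∧
      ∀ i, ∀ j ∈ J₁, j ≠ i₁ → i j ≠ s j → φ (fullMargin K J₁ i) = 0 := by
  obtain ⟨u, hu, hus, hu₀⟩ := exists_family_sum_eq_zero (E := K) s h₁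
  obtain ⟨v, hv, hvt, hv₀⟩ := exists_family_sum_eq_zero (E := K) t h₂
  have sum_u : ∀ j ≠ i₁, ∑ x, u j x = 1 := fun j hj => by simp [hu j hj]
  have sum_v : ∀ j ≠ i₂, ∑ x, v j x = 1 := fun j hj => by simp [hv j hj]
  refine ⟨twoTermPoint u v, twoFacetIdeal_le_ker_twoTermPoint sum_u hu₀ sum_v hv₀ hi₁ hi₂,
    fun J h₁ h₂ => ?_, fun J h₁ h₂ => ?_, fun i j hj hji hij => ?_⟩
  · rw [twoTermPoint_fullMargin_left sum_u hv₀ h₁ h₂, Finset.prod_eq_one fun j _ => hus j]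
  · rw [twoTermPoint_fullMargin_right hu₀ sum_v h₁ h₂, Finset.prod_eq_one fun j _ => hvt j]
  · rw [twoTermPoint_fullMargin_left sum_u hv₀ (Finset.mem_sdiff.1 hi₁).1
      (Finset.mem_sdiff.1 hi₂).2]
    exact Finset.prod_eq_zero hj (by rw [hu j hji, Pi.single_eq_of_ne hij])

theorem not_mainIdeal_le_twoFacetIdeal (h₁ : 2 ≤ a i₁) (h₂ : 2 ≤ a i₂) (hi₁ : i₁ ∈ J₁ \ J₂)
    (hi₂ : i₂ ∈ J₂ \ J₁) {c : Fin n} (hc : c ∈ J₁ ∩ J₂) (hac : 2 ≤ a c) :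
    ¬ mainIdeal K a {J₁, J₂} ≤ twoFacetIdeal K a {J₁, J₂} J₁ J₂ i₁ i₂ := by
  intro h
  have : Nontrivial (Fin (a c)) := Fin.nontrivial_iff_two_le.2 hac
  obtain ⟨r, hr⟩ := exists_ne (0 : Fin (a c))
  let s : (j : Fin n) → Fin (a j) := 0
  let t : (j : Fin n) → Fin (a j) := update s c r
  obtain ⟨φ, hφ, hs, ht, hzero⟩ := exists_twoFacetIdeal_le_ker K h₁ h₂ hi₁ hi₂ s t
  rw [Finset.mem_sdiff] at hi₁ hi₂
  rw [Finset.mem_inter] at hc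
  have minor := h.trans hφ (mixedMinor_mem_mainIdeal (Set.mem_insert J₁ {J₂})
    (Set.mem_insert_of_mem J₁ rfl) hc.1 hc.2 s t)
  have htc : update s c (t c) c ≠ s c := by simpa [t, s] using hr
  rw [RingHom.mem_ker, map_sub, map_mul, map_mul, hs J₁ hi₁.1 hi₂.2, ht J₂ hi₁.2 hi₂.1,
    hzero _ c hc.1 (ne_of_mem_of_not_mem hc.2 hi₁.2) htc] at minor
  simp at minor

theorem eq_of_twoFacetIdeal_le {k₁ k₂ : Fin n} (h₁ : 2 ≤ a k₁) (h₂ : 2 ≤ a k₂)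
    (hk₁ : k₁ ∈ J₁ \ J₂) (hk₂ : k₂ ∈ J₂ \ J₁)
    (h : twoFacetIdeal K a {J₁, J₂} J₁ J₂ i₁ i₂ ≤ twoFacetIdeal K a {J₁, J₂} J₁ J₂ k₁ k₂) :
    i₁ = k₁ ∧ i₂ = k₂ := by
  obtain ⟨φ, hφ, hs, ht, -⟩ := exists_twoFacetIdeal_le_ker K h₁ h₂ hk₁ hk₂ 0 0
  obtain ⟨-, zero₁, zero₂⟩ := (twoFacetIdeal_le_ker_iff _ _ _ _ _ _).1 (h.trans hφ)
  rw [Finset.mem_sdiff] at hk₁ hk₂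
  constructor
  · by_contra hne
    exact one_ne_zero <| (hs _ (Finset.mem_erase.2 ⟨Ne.symm hne, hk₁.1⟩)
      fun h => hk₂.2 (Finset.mem_of_mem_erase h)).symm.trans (zero₁ 0)
  · by_contra hne
    exact one_ne_zero <| (ht _ (fun h => hk₁.2 (Finset.mem_of_mem_erase h))
      (Finset.mem_erase.2 ⟨Ne.symm hne, hk₂.1⟩)).symm.trans (zero₂ 0)

end Antichain

theorem minimalPrimes_eq_of_antichain {R : Type*} [CommRing R] {I : Ideal R} {S : Set (Ideal R)}
    (hS : ∀ q ∈ S, q.IsPrime ∧ I ≤ q) (hcover : ∀ q : Ideal R, q.IsPrime → I ≤ q → ∃ p ∈ S, p ≤ q)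
    (hanti : IsAntichain (· ≤ ·) S) : I.minimalPrimes = S := by
  ext q
  constructor
  · rintro ⟨⟨hq, hIq⟩, hmin⟩
    obtain ⟨p, hp, hpq⟩ := hcover q hq hIq
    rwa [hpq.antisymm (hmin (hS p hp) hpq)] at hp
  · intro hq
    refine ⟨hS q hq, fun q' ⟨hq', hI⟩ hle => ?_⟩
    obtain ⟨p, hp, hpq⟩ := hcover q' hq' hI
    rwa [hanti.eq hp hq (hpq.trans hle)] at hpq

section Components

variable (K a) in
/-- The candidates for the minimal primes over `I_Δ` when `Δ` has the facets `J₁` and `J₂`: the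
ideal `P_Δ` and those `Q_{i₁,i₂}` for which no coordinate involved is trivial. -/
def components (J₁ J₂ : Finset (Fin n)) : Set (Ideal (TableRing K a)) :=
  {mainIdeal K a {J₁, J₂}} ∪
    {Q | ∃ i₁ ∈ J₁ \ J₂, ∃ i₂ ∈ J₂ \ J₁, (2 ≤ a i₁ ∧ 2 ≤ a i₂ ∧ ∃ c ∈ J₁ ∩ J₂, 2 ≤ a c) ∧
      Q = twoFacetIdeal K a {J₁, J₂} J₁ J₂ i₁ i₂}

variable [∀ j, NeZero (a j)] {J₁ J₂ : Finset (Fin n)}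

theorem independenceIdeal_le_of_mem_components {Q : Ideal (TableRing K a)}
    (hQ : Q ∈ components K a J₁ J₂) : independenceIdeal K a {J₁, J₂} ≤ Q := by
  obtain rfl | ⟨i₁, -, i₂, -, -, rfl⟩ := hQ
  · exact independenceIdeal_le_mainIdeal K a _
  · exact le_sup_left.trans le_sup_left

theorem isAntichain_components : IsAntichain (· ≤ ·) (components K a J₁ J₂) := by
  rintro p (rfl | ⟨i₁, -, i₂, -, -, rfl⟩) q
    (rfl | ⟨k₁, hk₁, k₂, hk₂, ⟨h₁, h₂, c, hc, hac⟩, rfl⟩) hne hle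
  · exact hne rfl
  · exact not_mainIdeal_le_twoFacetIdeal h₁ h₂ hk₁ hk₂ hc hac hle
  · have : NeZero n := ⟨i₁.pos.ne'⟩
    exact not_marginIdeal_le_mainIdeal _ _ (le_sup_right.trans hle)
  · obtain ⟨rfl, rfl⟩ := eq_of_twoFacetIdeal_le h₁ h₂ hk₁ hk₂ hle
    exact hne rfl

end Components

section Support

variable [∀ j, NeZero (a j)]

/-- The directions in which a cell differs from the base cell `0`. -/
def cellSupport (i : (j : Fin n) → Fin (a j)) : Finset (Fin n) :=
  Finset.univ.filter fun j => i j ≠ 0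

theorem mem_cellSupport {i : (j : Fin n) → Fin (a j)} {j : Fin n} :
    j ∈ cellSupport i ↔ i j ≠ 0 := by simp [cellSupport]

theorem cellSupport_piecewise (J : Finset (Fin n)) (i : (j : Fin n) → Fin (a j)) :
    cellSupport (J.piecewise i 0) = cellSupport i ∩ J := by
  ext j
  by_cases h : j ∈ J <;> simp [mem_cellSupport, h]

variable (K) in
/-- The entry of the margin on the support of a cell. These entries are the linear coordinates in
which every margin becomes, up to an invertible linear substitution, a subtable. -/
def supportMargin (i : (j : Fin n) → Fin (a j)) : TableRing K a :=
  fullMargin K (cellSupport i) i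

theorem supportMargin_piecewise (J : Finset (Fin n)) (i : (j : Fin n) → Fin (a j)) :
    supportMargin K (J.piecewise i 0) = fullMargin K (cellSupport i ∩ J) i := by
  rw [supportMargin, cellSupport_piecewise]
  exact dependsOn_fullMargin _ fun j hj =>
    Finset.piecewise_eq_of_mem _ _ _ (Finset.mem_inter.1 hj).2

theorem fullMargin_mem_span_of_ne_zero (E J : Finset (Fin n)) (i : (j : Fin n) → Fin (a j))
    (h : ∀ j ∈ J, j ∉ E → i j ≠ 0) :
    fullMargin K J i ∈ Submodule.span K (supportMargin K '' {k | cellSupport k ⊆ J}) := by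
  induction E using Finset.induction_on generalizing J i with
  | empty =>
    have hJ : cellSupport i ∩ J = J :=
      Finset.inter_eq_right.2 fun j hj => mem_cellSupport.2 (h j hj (Finset.notMem_empty j))
    refine Submodule.subset_span ⟨J.piecewise i 0, ?_, ?_⟩
    · rw [Set.mem_ofPred_eq, cellSupport_piecewise, hJ]
    · rw [supportMargin_piecewise, hJ]
  | insert l E hl ih =>
    have ne_zero_of_ne : ∀ j ∈ J, j ∉ E → j ≠ l → i j ≠ 0 := fun j hj hjE hjl =>
      h j hj fun h => (Finset.mem_insert.1 h).elim hjl hjE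
    by_cases hil : l ∈ J ∧ i l = 0
    · obtain ⟨hlJ, hil⟩ := hil
      have hsum := fullMargin_eq_sum_insert (K := K) (Finset.notMem_erase l J) i
      rw [Finset.insert_erase hlJ, ← Finset.add_sum_erase _ _ (Finset.mem_univ 0), ← hil,
        update_eq_self, ← sub_eq_iff_eq_add, hil] at hsum
      rw [← hsum]
      refine sub_mem ?_ (sum_mem fun v hv => ih J _ fun j hj hjE => ?_)
      · refine Submodule.span_mono (Set.image_mono fun k hk => ?_) (ih (J.erase l) i fun j hj hjE =>
          ne_zero_of_ne j (Finset.mem_of_mem_erase hj) hjE (Finset.ne_of_mem_erase hj))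
        exact Finset.Subset.trans hk (Finset.erase_subset l J)
      · obtain rfl | hjl := eq_or_ne j l
        · simpa using hv
        · simpa [hjl] using ne_zero_of_ne j hj hjE hjl
    · refine ih J i fun j hj hjE => ?_
      obtain rfl | hjl := eq_or_ne j l
      · exact fun h => hil ⟨hj, h⟩
      · exact ne_zero_of_ne j hj hjE hjl

theorem fullMargin_mem_span (J : Finset (Fin n)) (i : (j : Fin n) → Fin (a j)) :
    fullMargin K J i ∈ Submodule.span K (supportMargin K '' {k | cellSupport k ⊆ J}) :=
  fullMargin_mem_span_of_ne_zero Finset.univ J i fun j _ h => absurd (Finset.mem_univ j) h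

theorem adjoin_supportMargin :
    Algebra.adjoin K (Set.range (supportMargin K (a := a))) = ⊤ := by
  rw [eq_top_iff, ← adjoin_range_X, Algebra.adjoin_le_iff]
  rintro _ ⟨i, rfl⟩
  rw [← fullMargin_univ]
  exact (Algebra.span_le_adjoin K _)
    (Submodule.span_mono (Set.image_subset_range _ _) (fullMargin_mem_span _ i))

theorem algebraicIndependent_supportMargin :
    AlgebraicIndependent K (supportMargin K (a := a)) := by
  have : Algebra.IsAlgebraic (Algebra.adjoin K (Set.range (supportMargin K (a := a))))
      (TableRing K a) := by
    rw [adjoin_supportMargin]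
    exact ⟨fun f => isAlgebraic_algebraMap (⟨f, trivial⟩ : (⊤ : Subalgebra K (TableRing K a)))⟩
  refine (Algebra.IsAlgebraic.isTranscendenceBasis_of_lift_le_trdeg_of_finite K _ ?_).1
  rw [MvPolynomial.trdeg_of_isDomain, Cardinal.lift_lift]

variable (K a) in
/-- The linear change of coordinates from the table entries to the entries `supportMargin`. -/
def coordEquiv : TableRing K a ≃ₐ[K] TableRing K a :=
  AlgEquiv.ofBijective (aeval (supportMargin K)) ⟨algebraicIndependent_supportMargin, by
    rw [← AlgHom.range_eq_top, ← Algebra.adjoin_range_eq_range_aeval, adjoin_supportMargin]⟩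

theorem coordEquiv_X (i : (j : Fin n) → Fin (a j)) :
    coordEquiv K a (X i) = supportMargin K i := aeval_X _ _

end Support

/- The variables outside `p` are inert: over the polynomial ring in them, the extended ideal is
generated by constants. -/
theorem isPrime_map_rename_ker {σ D : Type*} [CommRing D] [IsDomain D] [Algebra K D]
    (p : σ → Prop) (f : MvPolynomial {i // p i} K →ₐ[K] D) :
    ((RingHom.ker f).map
      (rename Subtype.val : MvPolynomial {i // p i} K →ₐ[K] MvPolynomial σ K)).IsPrime := by
  classical
  let ι : MvPolynomial {i // p i} K →ₐ[K] MvPolynomial σ K := rename Subtype.val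
  let e : MvPolynomial σ K ≃ₐ[K] MvPolynomial {i // ¬ p i} (MvPolynomial {i // p i} K) :=
    (renameEquiv K ((Equiv.sumCompl p).symm.trans (Equiv.sumComm _ _))).trans
      (sumAlgEquiv K {i // ¬ p i} {i // p i})
  have comp_eq_C : e.toAlgHom.toRingHom.comp ι.toRingHom = C := by
    refine MvPolynomial.ringHom_ext (fun r => ?_) fun i => ?_
    · simp [e, ι]
    · simp [e, ι, Equiv.sumCompl_symm_apply_of_pos i.2]
  have prime_C : ((RingHom.ker f.toRingHom).map
      (C : _ →+* MvPolynomial {i // ¬ p i} (MvPolynomial {i // p i} K))).IsPrime := by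
    rw [← MvPolynomial.ker_map]
    exact RingHom.ker_isPrime _
  rw [← comp_eq_C, ← Ideal.map_map] at prime_C
  change ((RingHom.ker f.toRingHom).map ι.toRingHom).IsPrime
  rw [← Ideal.comap_map_of_bijective e.toAlgHom.toRingHom e.bijective
    (I := (RingHom.ker f.toRingHom).map ι.toRingHom)]
  exact Ideal.comap_isPrime _ _ (H := prime_C)

section MainIdeal

variable [∀ j, NeZero (a j)]

theorem range_tau_eq_range_coordEquiv (Δ : Set (Finset (Fin n))) :
    (tau K a Δ).range = ((coordEquiv K a).toAlgHom.comp (rename Subtype.val :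
      MvPolynomial {i : (j : Fin n) → Fin (a j) // ∃ J ∈ Δ, cellSupport i ⊆ J} K →ₐ[K]
        TableRing K a)).range := by
  have comp_eq_aeval : (coordEquiv K a).toAlgHom.comp (rename Subtype.val) =
      aeval fun i : {i : (j : Fin n) → Fin (a j) // ∃ J ∈ Δ, cellSupport i ⊆ J} =>
        supportMargin K i.1 := by
    refine algHom_ext fun i => ?_
    simp [coordEquiv_X]
  rw [comp_eq_aeval, ← Algebra.adjoin_range_eq_range_aeval, range_tau_eq_adjoin]
  refine le_antisymm (Algebra.adjoin_le ?_) (Algebra.adjoin_le ?_)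
  · rintro _ ⟨J, hJ, i, rfl⟩
    refine Algebra.span_le_adjoin K _ (Submodule.span_mono ?_ (fullMargin_mem_span J i))
    rintro _ ⟨k, hk, rfl⟩
    exact ⟨⟨k, J, hJ, hk⟩, rfl⟩
  · rintro _ ⟨⟨i, J, hJ, hi⟩, rfl⟩
    rw [← range_tau_eq_adjoin]
    exact fullMargin_mem_range_tau hJ hi i

variable (K a) in
theorem isPrime_mainIdeal (Δ : Set (Finset (Fin n))) : (mainIdeal K a Δ).IsPrime := by
  let ι : MvPolynomial {i : (j : Fin n) → Fin (a j) // ∃ J ∈ Δ, cellSupport i ⊆ J} K →ₐ[K]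
    TableRing K a := rename Subtype.val
  let g := (coordEquiv K a).toAlgHom.comp ι
  have eq_map : mainIdeal K a Δ =
      ((RingHom.ker ((segreMap K a).comp g)).map ι).map (coordEquiv K a) := by
    rw [mainIdeal_eq_span, range_tau_eq_range_coordEquiv, ← map_ker_comp_eq_span]
    exact (Ideal.map_map _ _).symm
  rw [eq_map]
  have := isPrime_map_rename_ker _ ((segreMap K a).comp g)
  exact Ideal.map_isPrime_of_equiv (coordEquiv K a)

end MainIdeal

section Substitution

theorem isSwap_iff_of_partialSum {ι : Type*} [DecidableEq ι] {β : ι → Type*} {R : Type*}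
    [CommRing R] {b b' : ((j : ι) → β j) → R} (j : ι) [Fintype (β j)] [DecidableEq (β j)] (o : β j)
    (h : ∀ i, b' i = if i j = o then ∑ x, b (update i j x) else b i) : IsSwap b ↔ IsSwap b' := by
  constructor
  · refine fun hb => hb.of_eq_sum_update j (fun v x => if v = o ∨ x = v then 1 else 0) fun i => ?_
    by_cases hi : i j = o <;> simp [h, hi]
  · refine fun hb => hb.of_eq_sum_update j
      (fun v x => if x = v then 1 else if v = o then -1 else 0) fun i => ?_
    by_cases hi : i j = o
    · subst hi
      have entry_eq_sub : b i = b' i - ∑ x ∈ Finset.univ.erase (i j), b' (update i j x) := by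
        rw [h, if_pos rfl, ← Finset.add_sum_erase _ _ (Finset.mem_univ (i j)), update_eq_self,
          eq_sub_iff_add_eq, add_right_inj]
        refine Finset.sum_congr rfl fun x hx => ?_
        rw [h, update_self, if_neg (Finset.ne_of_mem_erase hx)]
      rw [entry_eq_sub, ← Finset.add_sum_erase _ _ (Finset.mem_univ (i j)), if_pos rfl, one_mul,
        update_eq_self, sub_eq_add_neg, ← Finset.sum_neg_distrib, add_right_inj]
      refine Finset.sum_congr rfl fun x hx => ?_
      rw [if_neg (Finset.ne_of_mem_erase hx), if_pos rfl, neg_one_mul]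
    · simp only [if_neg hi, ite_mul, one_mul, zero_mul, Finset.sum_ite_eq', Finset.mem_univ,
        if_true, update_eq_self, h]

variable [∀ j, NeZero (a j)]

theorem isSwap_fullMargin_sdiff_iff {B F : Type*} [CommRing B] [FunLike F (TableRing K a) B]
    [AddMonoidHomClass F (TableRing K a) B] (φ : F) (J E : Finset (Fin n)) :
    (IsSwap fun i => φ (fullMargin K J i)) ↔
      IsSwap fun i => φ (fullMargin K (J \ (E \ cellSupport i)) i) := by
  induction E using Finset.induction_on with
  | empty => simp
  | insert l E hl ih =>
    rw [ih]
    by_cases hlJ : l ∈ J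
    · refine isSwap_iff_of_partialSum l 0 fun i => ?_
      split_ifs with hil
      · have hli : l ∉ cellSupport i := by simpa [mem_cellSupport] using hil
        rw [fullMargin_eq_sum_insert (l := l) (by simp [hli]), map_sum]
        refine Finset.sum_congr rfl fun v _ => ?_
        congr 2
        ext j
        obtain rfl | hj := eq_or_ne j l
        · simp [hlJ, hl]
        · simp [hj, mem_cellSupport]
      · rw [Finset.insert_sdiff_of_mem _ (mem_cellSupport.2 hil)]
    · have sdiff_eq : ∀ i : (j : Fin n) → Fin (a j), J \ (insert l E \ cellSupport i) =
          J \ (E \ cellSupport i) := fun i => by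
        ext j
        obtain rfl | hj := eq_or_ne j l
        · simp [hlJ]
        · simp [hj]
      simp only [sdiff_eq]

theorem isSwap_fullMargin_iff {B F : Type*} [CommRing B] [FunLike F (TableRing K a) B]
    [AddMonoidHomClass F (TableRing K a) B] (φ : F) (J : Finset (Fin n)) :
    (IsSwap fun i => φ (fullMargin K J i)) ↔
      IsSwap fun i => φ (supportMargin K (J.piecewise i 0)) := by
  rw [isSwap_fullMargin_sdiff_iff φ J Finset.univ]
  have sdiff_eq : ∀ i : (j : Fin n) → Fin (a j),
      J \ (Finset.univ \ cellSupport i) = cellSupport i ∩ J := fun i => by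
    ext j
    simp [and_comm]
  simp only [supportMargin_piecewise, sdiff_eq]

theorem map_fullMargin_eq_zero_iff {B : Type*} [CommRing B] [Algebra K B]
    (φ : TableRing K a →ₐ[K] B) (J : Finset (Fin n)) :
    (∀ i, φ (fullMargin K J i) = 0) ↔ ∀ i, cellSupport i ⊆ J → φ (supportMargin K i) = 0 := by
  refine ⟨fun h i hi => map_fullMargin_eq_zero φ hi i fun k _ => h k, fun h i => ?_⟩
  refine (Submodule.span_le (p := LinearMap.ker φ.toLinearMap)).2 ?_ (fullMargin_mem_span J i)
  rintro _ ⟨k, hk, rfl⟩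
  exact h k hk

end Substitution

theorem prod_map_single {R σ G : Type*} [CommSemiring R] [AddCommMonoid G] (e : σ → G)
    (m : Multiset σ) : (m.map fun i => AddMonoidAlgebra.single (e i) (1 : R)).prod =
      AddMonoidAlgebra.single (m.map e).sum 1 := by
  induction m using Multiset.induction_on with
  | empty => simp [AddMonoidAlgebra.one_def]
  | cons i m ih => simp [ih, AddMonoidAlgebra.single_mul_single]

theorem prod_map_X_toMultiset {R σ : Type*} [CommSemiring R] (s : σ →₀ ℕ) :
    ((Finsupp.toMultiset s).map (X : σ → MvPolynomial σ R)).prod = monomial s 1 := by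
  rw [monomial_eq, C_1, one_mul, Finsupp.toMultiset_map, Finsupp.prod_toMultiset,
    Finsupp.prod_mapDomain_index (by simp) (by simp [pow_add])]

theorem ker_aeval_single_le_ker {R σ G B : Type*} [CommRing R] [AddCommMonoid G] [CommRing B]
    [Algebra R B] (p : σ → Prop) [DecidablePred p] (e : σ → G) (χ : MvPolynomial σ R →ₐ[R] B)
    (hχ : ∀ i, ¬ p i → χ (X i) = 0)
    (h : ∀ m m' : Multiset σ, (∀ i ∈ m, p i) → (∀ i ∈ m', p i) → (m.map e).sum = (m'.map e).sum →
      (m.map fun i => χ (X i)).prod = (m'.map fun i => χ (X i)).prod) :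
    RingHom.ker (aeval fun i => if p i then AddMonoidAlgebra.single (e i) (1 : R) else 0) ≤
      RingHom.ker χ := by
  let Φ : MvPolynomial σ R →ₐ[R] AddMonoidAlgebra R G :=
    aeval fun i => if p i then AddMonoidAlgebra.single (e i) (1 : R) else 0
  let exponent : {m : Multiset σ // ∀ i ∈ m, p i} → G := fun m => (m.1.map e).sum
  let value : {m : Multiset σ // ∀ i ∈ m, p i} → B := fun m => (m.1.map fun i => χ (X i)).prod
  have value_factors : value.FactorsThrough exponent := fun m m' => h m m' m.2 m'.2
  let ψ : AddMonoidAlgebra R G →ₗ[R] B :=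
    (AddMonoidAlgebra.basis G R).constr R (extend exponent value 0)
  have ψ_comp : ψ ∘ₗ Φ.toLinearMap = χ.toLinearMap := by
    refine (basisMonomials σ R).ext fun s => ?_
    rw [coe_basisMonomials]
    change ψ (Φ (monomial s 1)) = χ (monomial s 1)
    rw [← prod_map_X_toMultiset]
    generalize Finsupp.toMultiset s = m
    simp only [map_multiset_prod, Multiset.map_map, comp_def]
    by_cases hm : ∀ i ∈ m, p i
    · have map_eq : m.map (fun i => Φ (X i)) =
          m.map fun i => AddMonoidAlgebra.single (e i) (1 : R) :=
        Multiset.map_congr rfl fun i hi => by simp [Φ, hm i hi]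
      rw [map_eq, prod_map_single, ← AddMonoidAlgebra.basis_apply, Module.Basis.constr_basis]
      exact value_factors.extend_apply 0 ⟨m, hm⟩
    · push Not at hm
      obtain ⟨i, hi, hpi⟩ := hm
      rw [Multiset.prod_eq_zero (Multiset.mem_map.2 ⟨i, hi, by simp [Φ, hpi]⟩), map_zero,
        Multiset.prod_eq_zero (Multiset.mem_map.2 ⟨i, hi, hχ i hpi⟩)]
  intro f hf
  have hΦf : Φ f = 0 := hf
  simpa [hΦf] using (LinearMap.congr_fun ψ_comp f).symm

theorem sum_map_ite_single {σ τ : Type*} [DecidableEq τ] (p : σ → Prop) [DecidablePred p]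
    (f : σ → τ) (m : Multiset σ) :
    (m.map fun i => if p i then Finsupp.single (f i) 1 else 0).sum =
      Multiset.toFinsupp ((m.filter p).map f) := by
  induction m using Multiset.induction_on with
  | empty => simp
  | cons i m ih =>
    by_cases hi : p i
    · rw [Multiset.filter_cons_of_pos _ hi, Multiset.map_cons, Multiset.map_cons,
        Multiset.sum_cons, ih, if_pos hi, ← Multiset.singleton_add, map_add,
        Multiset.toFinsupp_singleton]
    · simpa [hi] using ih

theorem eq_filter_add_filter_add_filter {σ : Type*} {p q r : σ → Prop} [DecidablePred p]
    [DecidablePred q] [DecidablePred r] (hpq : ∀ i, p i → ¬ q i) (hr : ∀ i, p i ∨ q i → ¬ r i)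
    {m : Multiset σ} (hm : ∀ i ∈ m, p i ∨ q i ∨ r i) :
    m = m.filter p + m.filter q + m.filter r := by
  induction m using Multiset.induction_on with
  | empty => simp
  | cons i m ih =>
    have split := ih fun k hk => hm k (Multiset.mem_cons_of_mem hk)
    rcases hm i (Multiset.mem_cons_self i m) with hp | hq | hri
    · have hq := hpq i hp
      have hri := hr i (Or.inl hp)
      simpa [hp, hq, hri] using split
    · have hp : ¬ p i := fun hp => hpq i hp hq
      have hri := hr i (Or.inr hq)
      simpa [hp, hq, hri] using split
    · have hp : ¬ p i := fun hp => hr i (Or.inl hp) hri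
      have hq : ¬ q i := fun hq => hr i (Or.inr hq) hri
      simpa [hp, hq, hri] using split

theorem isSwap_ite_single {ι : Type*} [DecidableEq ι] {β : ι → Type*} {R G : Type*} [Semiring R]
    [AddCommMonoid G] (l : ι) (p : β l → Prop) [DecidablePred p]
    (f : ((j : ι) → β j →₀ ℕ) →+ G) :
    IsSwap fun k : (j : ι) → β j => if p (k l) then
      AddMonoidAlgebra.single (f fun j => Finsupp.single (k j) 1) (1 : R) else 0 := by
  intro d i k
  have exponent_eq : (f fun j => Finsupp.single (i j) 1) + (f fun j => Finsupp.single (k j) 1) =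
      (f fun j => Finsupp.single (update k d (i d) j) 1) +
        f fun j => Finsupp.single (update i d (k d) j) 1 := by
    rw [← map_add, ← map_add]
    congr 1
    funext j
    obtain rfl | hj := eq_or_ne j d
    · simp
    · simp [hj, add_comm]
  obtain rfl | hl := eq_or_ne l d
  · by_cases hi : p (i l) <;> by_cases hk : p (k l) <;>
      simp [hi, hk, AddMonoidAlgebra.single_mul_single, exponent_eq]
  · by_cases hi : p (i l) <;> by_cases hk : p (k l) <;>
      simp [hi, hk, hl, AddMonoidAlgebra.single_mul_single, exponent_eq]

theorem IsSwap.comp_piecewise {ι : Type*} [DecidableEq ι] {β : ι → Type*} {M : Type*} [CommMagma M]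
    {b : ((j : ι) → β j) → M} (hb : IsSwap b) (J : Finset ι) (s : (j : ι) → β j) :
    IsSwap fun i => b (J.piecewise i s) := by
  intro l i k
  by_cases hl : l ∈ J
  · have h := hb l (J.piecewise i s) (J.piecewise k s)
    rw [Finset.piecewise_eq_of_mem _ _ _ hl, Finset.piecewise_eq_of_mem _ _ _ hl,
      Finset.update_piecewise_of_mem _ _ _ hl, Finset.update_piecewise_of_mem _ _ _ hl] at h
    exact h
  · have piecewise_update : ∀ (i : (j : ι) → β j) v,
        J.piecewise (update i l v) s = J.piecewise i s := fun i v =>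
      J.piecewise_congr (fun j hj => update_of_ne (ne_of_mem_of_not_mem hj hl) _ _)
        fun _ _ => rfl
    simp only [piecewise_update, mul_comm]

section StarParametrization

variable [∀ j, NeZero (a j)]

/-- The cells supported on `J` that move in the direction `l`: modulo the entries of
`A_{J ∖ {l}}`, these are the only entries of `A_J` that survive. -/
abbrev IsStarCell (J : Finset (Fin n)) (l : Fin n) (i : (j : Fin n) → Fin (a j)) : Prop :=
  cellSupport i ⊆ J ∧ i l ≠ 0

/-- The cells whose coordinate `supportMargin` does not occur in the margins of `J₁` and `J₂`. -/
abbrev IsFreeCell (J₁ J₂ : Finset (Fin n)) (i : (j : Fin n) → Fin (a j)) : Prop :=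
  ¬ cellSupport i ⊆ J₁ ∧ ¬ cellSupport i ⊆ J₂

variable (a) in
/-- Exponents of the monomials in the parameters of `starParam`: one copy of the variables
`y_{j,v}` for each of the two facets, and one variable for each cell. -/
abbrev StarExponent : Type :=
  ((j : Fin n) → Fin (a j) →₀ ℕ) × ((j : Fin n) → Fin (a j) →₀ ℕ) ×
    (((j : Fin n) → Fin (a j)) →₀ ℕ)

/-- The exponent of the monomial that `starParam` assigns to a cell. -/
def starExponent (J₁ J₂ : Finset (Fin n)) (i₁ i₂ : Fin n) (i : (j : Fin n) → Fin (a j)) :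
    StarExponent a :=
  (if IsStarCell J₁ i₁ i then fun j => Finsupp.single (i j) 1 else 0,
    if IsStarCell J₂ i₂ i then fun j => Finsupp.single (i j) 1 else 0,
    if IsFreeCell J₁ J₂ i then Finsupp.single i 1 else 0)

variable (K a) in
/-- The monomial parametrization of the component `twoFacetIdeal`, in the coordinates
`supportMargin`: the cells of the two stars are mapped as in the Segre parametrization, with
independent parameters, the free cells to independent variables, and all other cells to `0`. -/
def starParam (J₁ J₂ : Finset (Fin n)) (i₁ i₂ : Fin n) :
    TableRing K a →ₐ[K] AddMonoidAlgebra K (StarExponent a) :=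
  (aeval fun i => if IsStarCell J₁ i₁ i ∨ IsStarCell J₂ i₂ i ∨ IsFreeCell J₁ J₂ i then
    AddMonoidAlgebra.single (starExponent J₁ J₂ i₁ i₂ i) 1 else 0).comp
      (coordEquiv K a).symm.toAlgHom

theorem starParam_supportMargin (J₁ J₂ : Finset (Fin n)) (i₁ i₂ : Fin n)
    (i : (j : Fin n) → Fin (a j)) :
    starParam K a J₁ J₂ i₁ i₂ (supportMargin K i) =
      if IsStarCell J₁ i₁ i ∨ IsStarCell J₂ i₂ i ∨ IsFreeCell J₁ J₂ i then
        AddMonoidAlgebra.single (starExponent J₁ J₂ i₁ i₂ i) 1 else 0 := by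
  rw [← coordEquiv_X]
  simp [starParam]

theorem IsStarCell.not_subset {J J' : Finset (Fin n)} {l : Fin n} {i : (j : Fin n) → Fin (a j)}
    (hi : IsStarCell J l i) (hl : l ∉ J') : ¬ cellSupport i ⊆ J' := fun h =>
  hl (h (mem_cellSupport.2 hi.2))

variable {J₁ J₂ : Finset (Fin n)} {i₁ i₂ : Fin n}

theorem starParam_supportMargin_of_subset_left (hi₂ : i₂ ∉ J₁) {i : (j : Fin n) → Fin (a j)}
    (hi : cellSupport i ⊆ J₁) :
    starParam K a J₁ J₂ i₁ i₂ (supportMargin K i) = if i i₁ ≠ 0 then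
      AddMonoidAlgebra.single (AddMonoidHom.inl _ _ fun j => Finsupp.single (i j) 1) 1 else 0 := by
  have not_star : ¬ IsStarCell J₂ i₂ i := fun h => h.not_subset hi₂ hi
  rw [starParam_supportMargin, starExponent]
  by_cases h : i i₁ = 0 <;> simp [IsFreeCell, IsStarCell, hi, h, not_star]
  rfl

theorem starParam_supportMargin_of_subset_right (hi₁ : i₁ ∉ J₂) {i : (j : Fin n) → Fin (a j)}
    (hi : cellSupport i ⊆ J₂) :
    starParam K a J₁ J₂ i₁ i₂ (supportMargin K i) = if i i₂ ≠ 0 then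
      AddMonoidAlgebra.single ((AddMonoidHom.inr _ _).comp (AddMonoidHom.inl _ _)
        fun j => Finsupp.single (i j) 1) 1 else 0 := by
  have not_star : ¬ IsStarCell J₁ i₁ i := fun h => h.not_subset hi₁ hi
  rw [starParam_supportMargin, starExponent]
  by_cases h : i i₂ = 0 <;> simp [IsFreeCell, IsStarCell, hi, h, not_star]

theorem isSwap_and_eq_zero_of_supportMargin_eq_ite {G : Type*} [AddCommMonoid G]
    (φ : TableRing K a →ₐ[K] AddMonoidAlgebra K G) {J : Finset (Fin n)} {l : Fin n}
    (f : ((j : Fin n) → Fin (a j) →₀ ℕ) →+ G)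
    (h : ∀ i, cellSupport i ⊆ J → φ (supportMargin K i) =
      if i l ≠ 0 then AddMonoidAlgebra.single (f fun j => Finsupp.single (i j) 1) 1 else 0) :
    (IsSwap fun i => φ (fullMargin K J i)) ∧ ∀ i, φ (fullMargin K (J.erase l) i) = 0 := by
  constructor
  · have apply_piecewise := fun i : (j : Fin n) → Fin (a j) => h (J.piecewise i 0) (by
      rw [cellSupport_piecewise]
      exact Finset.inter_subset_right)
    rw [isSwap_fullMargin_iff]
    simp only [apply_piecewise]
    have swap := isSwap_ite_single (R := K) l (fun v : Fin (a l) => v ≠ 0) f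
    exact swap.comp_piecewise J 0
  · refine (map_fullMargin_eq_zero_iff φ _).2 fun i hi => ?_
    rw [h i (hi.trans (Finset.erase_subset l J)), if_neg]
    exact fun hil => Finset.notMem_erase l J (hi (mem_cellSupport.2 hil))

theorem twoFacetIdeal_le_ker_starParam (hi₁ : i₁ ∉ J₂) (hi₂ : i₂ ∉ J₁) :
    twoFacetIdeal K a {J₁, J₂} J₁ J₂ i₁ i₂ ≤ RingHom.ker (starParam K a J₁ J₂ i₁ i₂) := by
  obtain ⟨swap₁, zero₁⟩ := isSwap_and_eq_zero_of_supportMargin_eq_ite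
    (starParam K a J₁ J₂ i₁ i₂) _ fun i =>
      starParam_supportMargin_of_subset_left hi₂
  obtain ⟨swap₂, zero₂⟩ := isSwap_and_eq_zero_of_supportMargin_eq_ite
    (starParam K a J₁ J₂ i₁ i₂) _ fun i =>
      starParam_supportMargin_of_subset_right hi₁
  exact (twoFacetIdeal_le_ker_iff _ _ _ _ _ _).2 ⟨by simp [swap₁, swap₂], zero₁, zero₂⟩

theorem sum_map_starExponent (m : Multiset ((j : Fin n) → Fin (a j))) :
    (m.map (starExponent J₁ J₂ i₁ i₂)).sum =
      (fun j => Multiset.toFinsupp ((m.filter (IsStarCell J₁ i₁)).map fun i => i j),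
        fun j => Multiset.toFinsupp ((m.filter (IsStarCell J₂ i₂)).map fun i => i j),
        Multiset.toFinsupp (m.filter (IsFreeCell J₁ J₂))) := by
  have map_sum_eq : ∀ {M : Type} [AddCommMonoid M] (f : StarExponent a →+ M),
      f (m.map (starExponent J₁ J₂ i₁ i₂)).sum =
        (m.map fun i => f (starExponent J₁ J₂ i₁ i₂ i)).sum := fun f => by
    rw [map_multiset_sum, Multiset.map_map, comp_def]
  refine Prod.ext (funext fun j => ?_) (Prod.ext (funext fun j => ?_) ?_)
  · refine (map_sum_eq ((Pi.evalAddMonoidHom _ j).comp (AddMonoidHom.fst _ _))).trans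
      (Eq.trans ?_ (sum_map_ite_single (IsStarCell J₁ i₁) (fun i => i j) m))
    simp [starExponent, ite_apply]
  · refine (map_sum_eq ((Pi.evalAddMonoidHom _ j).comp
      ((AddMonoidHom.fst _ _).comp (AddMonoidHom.snd _ _)))).trans
        (Eq.trans ?_ (sum_map_ite_single (IsStarCell J₂ i₂) (fun i => i j) m))
    simp [starExponent, ite_apply]
  · have free := sum_map_ite_single (IsFreeCell J₁ J₂) id m
    rw [Multiset.map_id] at free
    exact (map_sum_eq ((AddMonoidHom.snd _ _).comp (AddMonoidHom.snd _ _))).trans free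

theorem prod_map_eq_of_cellSupport_subset [Nonempty (Fin n)] {M : Type*} [CommMonoid M]
    {b : ((j : Fin n) → Fin (a j)) → M} {J : Finset (Fin n)}
    (hb : IsSwap fun i => b (J.piecewise i 0)) {m m' : Multiset ((j : Fin n) → Fin (a j))}
    (hm : ∀ i ∈ m, cellSupport i ⊆ J) (hm' : ∀ i ∈ m', cellSupport i ⊆ J)
    (h : ∀ j, m.map (fun i => i j) = m'.map fun i => i j) :
    (m.map b).prod = (m'.map b).prod := by
  have map_piecewise : ∀ {m : Multiset ((j : Fin n) → Fin (a j))}, (∀ i ∈ m, cellSupport i ⊆ J) →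
      m.map b = m.map fun i => b (J.piecewise i 0) := fun {m} hm =>
    Multiset.map_congr rfl fun i hi => by
      congr 1
      funext j
      by_cases hj : j ∈ J
      · rw [Finset.piecewise_eq_of_mem _ _ _ hj]
      · rw [Finset.piecewise_eq_of_notMem _ _ _ hj]
        by_contra hij
        exact hj (hm i hi (mem_cellSupport.2 hij))
  rw [map_piecewise hm, map_piecewise hm', hb.prod_eq_prod h]

theorem prod_map_eq_of_sum_starExponent_eq {M : Type*} [CommMonoid M]
    {b : ((j : Fin n) → Fin (a j)) → M} (hi₂ : i₂ ∉ J₁)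
    (hb₁ : IsSwap fun i => b (J₁.piecewise i 0)) (hb₂ : IsSwap fun i => b (J₂.piecewise i 0))
    {m m' : Multiset ((j : Fin n) → Fin (a j))}
    (hm : ∀ i ∈ m, IsStarCell J₁ i₁ i ∨ IsStarCell J₂ i₂ i ∨ IsFreeCell J₁ J₂ i)
    (hm' : ∀ i ∈ m', IsStarCell J₁ i₁ i ∨ IsStarCell J₂ i₂ i ∨ IsFreeCell J₁ J₂ i)
    (h : (m.map (starExponent J₁ J₂ i₁ i₂)).sum = (m'.map (starExponent J₁ J₂ i₁ i₂)).sum) :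
    (m.map b).prod = (m'.map b).prod := by
  have : Nonempty (Fin n) := ⟨i₁⟩
  have star_disjoint : ∀ i : (j : Fin n) → Fin (a j), IsStarCell J₁ i₁ i → ¬ IsStarCell J₂ i₂ i :=
    fun i hi hi' => hi'.not_subset hi₂ hi.1
  have star_not_free : ∀ i : (j : Fin n) → Fin (a j),
      IsStarCell J₁ i₁ i ∨ IsStarCell J₂ i₂ i → ¬ IsFreeCell J₁ J₂ i := fun i hi hfree =>
    hi.elim (fun hi => hfree.1 hi.1) fun hi => hfree.2 hi.1
  simp only [sum_map_starExponent, Prod.mk.injEq, funext_iff, EmbeddingLike.apply_eq_iff_eq] at h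
  obtain ⟨star₁_eq, star₂_eq, free_eq⟩ := h
  rw [eq_filter_add_filter_add_filter star_disjoint star_not_free hm,
    eq_filter_add_filter_add_filter star_disjoint star_not_free hm']
  simp only [Multiset.map_add, Multiset.prod_add]
  rw [free_eq, prod_map_eq_of_cellSupport_subset hb₁ (fun i hi => (Multiset.mem_filter.1 hi).2.1)
      (fun i hi => (Multiset.mem_filter.1 hi).2.1) star₁_eq,
    prod_map_eq_of_cellSupport_subset hb₂ (fun i hi => (Multiset.mem_filter.1 hi).2.1)
      (fun i hi => (Multiset.mem_filter.1 hi).2.1) star₂_eq]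

theorem ker_starParam_le_twoFacetIdeal (hi₂ : i₂ ∉ J₁) :
    RingHom.ker (starParam K a J₁ J₂ i₁ i₂) ≤ twoFacetIdeal K a {J₁, J₂} J₁ J₂ i₁ i₂ := by
  let π := Ideal.Quotient.mkₐ K (twoFacetIdeal K a {J₁, J₂} J₁ J₂ i₁ i₂)
  let χ := π.comp (coordEquiv K a).toAlgHom
  have χ_X : ∀ i, χ (X i) = π (supportMargin K i) := fun i => congrArg π (coordEquiv_X i)
  obtain ⟨swap, zero₁, zero₂⟩ := (twoFacetIdeal_le_ker_iff π {J₁, J₂} J₁ J₂ i₁ i₂).1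
    (Ideal.Quotient.mkₐ_ker K _).ge
  simp only [isSwap_fullMargin_iff, map_fullMargin_eq_zero_iff, ← χ_X] at swap zero₁ zero₂
  have eq_zero : ∀ i : (j : Fin n) → Fin (a j),
      ¬ (IsStarCell J₁ i₁ i ∨ IsStarCell J₂ i₂ i ∨ IsFreeCell J₁ J₂ i) → χ (X i) = 0 := by
    intro i hi
    simp only [not_or, not_and_or, not_not] at hi
    have subset_erase : ∀ {J : Finset (Fin n)} {l}, cellSupport i ⊆ J → i l = 0 →
        cellSupport i ⊆ J.erase l := fun hJ hl =>
      Finset.subset_erase.2 ⟨hJ, fun h => mem_cellSupport.1 h hl⟩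
    obtain ⟨not_star₁, not_star₂, hJ₁ | hJ₂⟩ := hi
    · exact zero₁ i (subset_erase hJ₁ (not_star₁.resolve_left (not_not.2 hJ₁)))
    · exact zero₂ i (subset_erase hJ₂ (not_star₂.resolve_left (not_not.2 hJ₂)))
  have ker_le := ker_aeval_single_le_ker _ _ χ eq_zero fun m m' =>
    prod_map_eq_of_sum_starExponent_eq hi₂ (swap J₁ (by simp))
      (swap J₂ (by simp))
  intro f hf
  have hχ : χ ((coordEquiv K a).symm f) = 0 := ker_le hf
  rw [← Ideal.Quotient.eq_zero_iff_mem]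
  simpa [χ, π] using hχ

theorem isPrime_twoFacetIdeal (hi₁ : i₁ ∉ J₂) (hi₂ : i₂ ∉ J₁) :
    (twoFacetIdeal K a {J₁, J₂} J₁ J₂ i₁ i₂).IsPrime := by
  rw [(twoFacetIdeal_le_ker_starParam hi₁ hi₂).antisymm (ker_starParam_le_twoFacetIdeal hi₂)]
  exact RingHom.ker_isPrime _

end StarParametrization

section MinimalPrimes

variable [∀ j, NeZero (a j)] {J₁ J₂ : Finset (Fin n)}

theorem minimalPrimes_independenceIdeal (hne₁ : (J₁ \ J₂).Nonempty) (hne₂ : (J₂ \ J₁).Nonempty) :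
    (independenceIdeal K a {J₁, J₂}).minimalPrimes = components K a J₁ J₂ := by
  refine minimalPrimes_eq_of_antichain
    (fun Q hQ => ⟨?_, independenceIdeal_le_of_mem_components hQ⟩) (fun q _ hq => ?_)
    isAntichain_components
  · obtain rfl | ⟨i₁, h₁, i₂, h₂, -, rfl⟩ := hQ
    · exact isPrime_mainIdeal K a _
    · exact isPrime_twoFacetIdeal (Finset.mem_sdiff.1 h₁).2 (Finset.mem_sdiff.1 h₂).2
  · obtain hP | ⟨i₁, h₁, i₂, h₂, hcond, hQ⟩ := mainIdeal_le_or_exists_twoFacetIdeal_le hne₁ hne₂ hq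
    · exact ⟨_, Or.inl rfl, hP⟩
    · exact ⟨_, Or.inr ⟨i₁, h₁, i₂, h₂, hcond, rfl⟩, hQ⟩

variable (K a) in
theorem twoFacetIdeal_facets (Δ : Set (Finset (Fin n))) (J₁ J₂ : Finset (Fin n)) (i₁ i₂ : Fin n) :
    twoFacetIdeal K a (facets Δ) J₁ J₂ i₁ i₂ = twoFacetIdeal K a Δ J₁ J₂ i₁ i₂ := by
  rw [twoFacetIdeal, twoFacetIdeal, independenceIdeal_facets]

end MinimalPrimes

end MarginalIndependence

end

open MarginalIndependence in
theorem mainTheorem8_general {K : Type*} [Field K] {n : ℕ} (a : Fin n → ℕ) (ha : ∀ j, 1 ≤ a j)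
    (Δ : Set (Finset (Fin n))) (J₁ J₂ : Finset (Fin n)) (hJ : J₁ ≠ J₂)
    (hfacets : facets Δ = {J₁, J₂}) :
    (∀ i₁ ∈ J₁ \ J₂, ∀ i₂ ∈ J₂ \ J₁,
      (twoFacetIdeal K a Δ J₁ J₂ i₁ i₂).IsPrime) ∧
    ((∀ j, 2 ≤ a j) → (J₁ ∩ J₂).Nonempty →
      (independenceIdeal K a Δ).minimalPrimes =
        {mainIdeal K a Δ} ∪
          {Q | ∃ i₁ ∈ J₁ \ J₂, ∃ i₂ ∈ J₂ \ J₁,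
            Q = twoFacetIdeal K a Δ J₁ J₂ i₁ i₂}) ∧
    (independenceIdeal K a Δ).minimalPrimes =
      {mainIdeal K a Δ} ∪
        {Q | ∃ i₁ ∈ J₁ \ J₂, ∃ i₂ ∈ J₂ \ J₁,
          (2 ≤ a i₁ ∧ 2 ≤ a i₂ ∧ ∃ c ∈ J₁ ∩ J₂, 2 ≤ a c) ∧
          Q = twoFacetIdeal K a Δ J₁ J₂ i₁ i₂} := by
  have : ∀ j, NeZero (a j) := fun j => ⟨Nat.one_le_iff_ne_zero.1 (ha j)⟩
  have hJ₁ : J₁ ∈ facets Δ := hfacets ▸ Set.mem_insert J₁ {J₂}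
  have hJ₂ : J₂ ∈ facets Δ := hfacets ▸ Set.mem_insert_of_mem J₁ rfl
  have hmin := minimalPrimes_independenceIdeal (K := K) (a := a)
    (sdiff_nonempty_of_mem_facets hJ₁ hJ₂ hJ) (sdiff_nonempty_of_mem_facets hJ₂ hJ₁ hJ.symm)
  rw [components] at hmin
  simp only [← twoFacetIdeal_facets K a Δ, ← independenceIdeal_facets K a Δ,
    ← mainIdeal_facets K a Δ, hfacets]
  refine ⟨fun i₁ h₁ i₂ h₂ =>
    isPrime_twoFacetIdeal (Finset.mem_sdiff.1 h₁).2 (Finset.mem_sdiff.1 h₂).2, ?_, hmin⟩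
  intro ha2 hC
  have exists_common : ∃ c, c ∈ J₁ ∩ J₂ := hC
  simpa only [ha2, exists_common, and_true, true_and] using hmin

theorem mainTheorem8 {K : Type*} [Field K] {n : ℕ} (a : Fin n → ℕ) (ha : ∀ j, 1 ≤ a j)
    (Δ : Set (Finset (Fin n))) (hΔ : IsLowerSet Δ) (J₁ J₂ : Finset (Fin n)) (hJ : J₁ ≠ J₂)
    (hfacets : MarginalIndependence.facets Δ = {J₁, J₂}) :
    (∀ i₁ ∈ J₁ \ J₂, ∀ i₂ ∈ J₂ \ J₁,
      (MarginalIndependence.twoFacetIdeal K a Δ J₁ J₂ i₁ i₂).IsPrime) ∧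
    ((∀ j, 2 ≤ a j) → (J₁ ∩ J₂).Nonempty →
      (MarginalIndependence.independenceIdeal K a Δ).minimalPrimes =
        {MarginalIndependence.mainIdeal K a Δ} ∪
          {Q | ∃ i₁ ∈ J₁ \ J₂, ∃ i₂ ∈ J₂ \ J₁,
            Q = MarginalIndependence.twoFacetIdeal K a Δ J₁ J₂ i₁ i₂}) ∧
    (MarginalIndependence.independenceIdeal K a Δ).minimalPrimes =
      {MarginalIndependence.mainIdeal K a Δ} ∪
        {Q | ∃ i₁ ∈ J₁ \ J₂, ∃ i₂ ∈ J₂ \ J₁,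
          (2 ≤ a i₁ ∧ 2 ≤ a i₂ ∧ ∃ c ∈ J₁ ∩ J₂, 2 ≤ a c) ∧
          Q = MarginalIndependence.twoFacetIdeal K a Δ J₁ J₂ i₁ i₂} :=
  mainTheorem8_general a ha Δ J₁ J₂ hJ hfacets
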